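/- Let $\beta>0$ and let $\nu$ be a Borel probability measure on $\mathbb R$ with $\int_{\mathbb R} h^2\,d\nu(h)<\infty$. Let $\mathbf h=(h_i)_{i\ge 1}$ have law $\mu=\nu^{\otimes\mathbb N}$, i.e. the $h_i$ are i.i.d. with law $\nu$. For $n\ge1$ let $P_{n,\beta}^{\mathbf h}$ be the Gibbs measure of the random-field Curie–Weiss model on $\{-1,+1\}^n$, $$P_{n,\beta}^{\mathbf h}(\sigma)=\frac{1}{Z_{n,\beta}^{\mathbf h}}\exp\Big(\frac{\beta}{2n}\Big[\sum_{i=1}^n\sigma_i\Big]^2+\beta\sum_{i=1}^n h_i\sigma_i\Big),$$ where $Z_{n,\beta}^{\mathbf h}$ is the normalizing constant, and let $S_n=\sum_{i=1}^n\sigma_i$. Put $$G(x)=\frac{\beta}{2}x^2-\int_{\mathbb R}\ln\cosh[\beta(x+h)]\,d\nu(h),\qquad x\in\mathbb R.$$ Suppose that $G$ has a unique global minimum point $m$, and that $m$ is of type $k\in\{1,2,\dots\}$ and strength $\lambda>0$, i.e. $$G(x)=G(m)+\frac{\lambda}{(2k)!}(x-m)^{2k}+\mathcal O\big((x-m)^{2k+1}\big)\quad\text{as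 }x\to m.$$ Then, for $\mu$-almost every realization of $\mathbf h$, the following holds for every $\alpha$ with $1-\frac{1}{2(2k-1)}<\alpha<1$: the laws $\rho_n$ of $(S_n-nm)/n^{\alpha}$ under $P_{n,\beta}^{\mathbf h}$, $n\ge1$, satisfy a moderate deviations principle with speed $a_n=n^{1-2k(1-\alpha)}$ and rate function $$I(x)=\begin{cases}\dfrac{x^2}{2(\lambda^{-1}-\beta^{-1})},& k=1,\\[2mm] \dfrac{\lambda x^{2k}}{(2k)!},& k\ge2,\end{cases}$$ that is, $I$ is lower semicontinuous with compact level sets $\{I\le c\}$, $c\in\mathbb R$, and for every Borel set $C\subseteq\mathbb R$ $$-\inf_{x\in C^\circ}I(x)\le\liminf_{n\to\infty}\frac1{a_n}\ln\rho_n(C)\le\limsup_{n\to\infty}\frac1{a_n}\ln\rho_n(C)\le-\inf_{x\in\overline C}I(x),$$ with the conventions $\ln 0=-\infty$ and $\inf\emptyset=+\infty$. -/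

import Mathlib

open MeasureTheory Filter Topology Asymptotics

noncomputable section

namespace RFCW

/-- Total magnetization `S_n(σ) = ∑ σ_i` of a configuration `σ ∈ {-1,+1}^n`; the spin space
`{-1,+1}` is the group of units of `ℤ`. -/
def magnetization {n : ℕ} (σ : Fin n → ℤˣ) : ℝ :=
  ∑ i, ((σ i : ℤ) : ℝ)

/-- The Hamiltonian of the random field Curie-Weiss model with field `h`. -/
def hamiltonian (h : ℕ → ℝ) {n : ℕ} (σ : Fin n → ℤˣ) : ℝ :=
  -(1 / (2 * (n : ℝ))) * ∑ i, ∑ j, ((σ i : ℤ) : ℝ) * ((σ j : ℤ) : ℝ)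
    - ∑ i : Fin n, h i * ((σ i : ℤ) : ℝ)

/-- The partition function at inverse temperature `β`. -/
def partitionFunction (β : ℝ) (h : ℕ → ℝ) (n : ℕ) : ℝ :=
  ∑ σ : Fin n → ℤˣ, Real.exp (-β * hamiltonian h σ)

/-- The Gibbs measure on `{-1,+1}^n` at inverse temperature `β` for the field `h`. -/
def gibbsMeasure (β : ℝ) (h : ℕ → ℝ) (n : ℕ) : Measure (Fin n → ℤˣ) :=
  ∑ σ : Fin n → ℤˣ,
    ENNReal.ofReal (Real.exp (-β * hamiltonian h σ) / partitionFunction β h n) •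
      Measure.dirac σ

/-- The law of `(S_n - n m) / n^α` under the Gibbs measure. -/
def scaledMagnetizationLaw (β : ℝ) (h : ℕ → ℝ) (m α : ℝ) (n : ℕ) : Measure ℝ :=
  (gibbsMeasure β h n).map fun σ => (magnetization σ - n * m) / (n : ℝ) ^ α

/-- The function `G(x) = β x² / 2 - ∫ log cosh (β (x + h)) dν(h)`. -/
def G (β : ℝ) (ν : Measure ℝ) (x : ℝ) : ℝ :=
  β / 2 * x ^ 2 - ∫ h, Real.log (Real.cosh (β * (x + h))) ∂ν

/-- `ν` is pure and centered at `m`: the set of global minimizers of `G` is `{m}`. -/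
def IsPureCenteredAt (β : ℝ) (ν : Measure ℝ) (m : ℝ) : Prop :=
  {x : ℝ | IsMinOn (G β ν) Set.univ x} = {m}

/-- `m` is of type `k ∈ {1, 2, …}` and strength `lam > 0`. -/
structure HasTypeStrength (β : ℝ) (ν : Measure ℝ) (m : ℝ) (k : ℕ) (lam : ℝ) : Prop where
  one_le_type : 1 ≤ k
  strength_pos : 0 < lam
  expansion :
    (fun x : ℝ => G β ν x - (G β ν m + lam / ((2 * k).factorial : ℝ) * (x - m) ^ (2 * k)))
      =O[𝓝 m] fun x : ℝ => (x - m) ^ (2 * k + 1)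

/-- The sequence `P` of measures on `ℝ` satisfies a large (or moderate) deviations principle with
speed `a` and good rate function `I`. Logarithms, limits and infima are taken in `[-∞, ∞]`, so
that `log 0 = -∞` and the infimum over the empty set is `+∞`. -/
structure SatisfiesLDP (P : ℕ → Measure ℝ) (a : ℕ → ℝ) (I : ℝ → EReal) : Prop where
  lowerSemicontinuous : LowerSemicontinuous I
  isCompact_level : ∀ c : ℝ, IsCompact {x : ℝ | I x ≤ (c : EReal)}
  lower_bound : ∀ C : Set ℝ, MeasurableSet C →
    -(⨅ x ∈ interior C, I x) ≤
      liminf (fun n : ℕ => ENNReal.log (P n C) / ((a n : ℝ) : EReal)) atTop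
  upper_bound : ∀ C : Set ℝ, MeasurableSet C →
    limsup (fun n : ℕ => ENNReal.log (P n C) / ((a n : ℝ) : EReal)) atTop ≤
      -(⨅ x ∈ closure C, I x)

/-- The rate function: `x² / (2 σ²)` with `σ² = lam⁻¹ - β⁻¹` if `k = 1`, and
`lam x^{2k} / (2k)!` otherwise. -/
def rateFunction (β : ℝ) (k : ℕ) (lam x : ℝ) : ℝ :=
  if k = 1 then x ^ 2 / (2 * (lam⁻¹ - β⁻¹))
  else lam * x ^ (2 * k) / ((2 * k).factorial : ℝ)

end RFCW

end

/-! Completing the square linearizes the interaction. For any external field `x`, a Gibbs weight is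
`exp (n β (S/n - x)^2 / 2)` times the weight of a product measure with total mass `2^n exp (-empG
x)` (`weight_eq`, `sum_tilted`). Here `x` is free and may depend on the magnetization.

Since `S` takes at most `2n + 1` values, the weight near `S/n = u` is bounded above, up to a
polynomial factor, by `2^n exp (n β (u - x)^2 / 2 - empG x)` for any `x` (`sum_weight_le`). A
matching lower bound holds when `x` gives the product measure a mean close to `n u`, because that
measure concentrates (`sum_weight_ge`). To leading order the same `x` serves both: the stationary
point of `β (u - x)^2 / 2 - G x` solves `x - G' x / β = u`, and the left side is the mean of `tanh
(β (x + h))`. For `u = m + w` this gives `x ≈ m + c w`, and the Taylor expansion of `G` at `m` turns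
the exponent into `-A w^(2k)` (`exists_local_expansion`).

It remains to replace `empG` by `n G`. Only increments from `m` matter, and they differ by at most
`|x - m|` times the fluctuation of the `tanh` sums (`abs_empG_sub_le`). Hoeffding's inequality, a
grid and Borel–Cantelli make that fluctuation at most `n^(1/2 + e)` almost surely, locally uniformly
in `x` (`ae_eventually_abs_sum_tanh_le`). With `w` of order `n^(α - 1)` this is negligible against
the speed exactly when `α > 1 - 1/(2(2k - 1))`. -/

namespace RFCW

/-! ### Hyperbolic functions -/

lemma hasDerivAt_log_cosh (x : ℝ) :
    HasDerivAt (fun y => Real.log (Real.cosh y)) (Real.tanh x) x := by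
  rw [Real.tanh_eq_sinh_div_cosh]
  exact (Real.hasDerivAt_cosh x).log (Real.cosh_pos x).ne'

lemma hasDerivAt_tanh (x : ℝ) : HasDerivAt Real.tanh (1 / Real.cosh x ^ 2) x := by
  have h := (Real.hasDerivAt_sinh x).div (Real.hasDerivAt_cosh x) (Real.cosh_pos x).ne'
  have h2 : Real.tanh = Real.sinh / Real.cosh := by
    ext y; simp [Real.tanh_eq_sinh_div_cosh]
  rw [h2]
  refine h.congr_deriv ?_
  rw [← sq, ← sq, Real.cosh_sq_sub_sinh_sq]

lemma abs_tanh_le_one (x : ℝ) : |Real.tanh x| ≤ 1 := by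
  rw [Real.tanh_eq_sinh_div_cosh, abs_div, abs_of_pos (Real.cosh_pos x),
    div_le_one (Real.cosh_pos x)]
  apply abs_le_of_sq_le_sq _ (Real.cosh_pos x).le
  have := Real.cosh_sq x
  linarith

lemma one_div_cosh_sq_pos (x : ℝ) : 0 < 1 / Real.cosh x ^ 2 := by
  have := Real.cosh_pos x
  positivity

lemma one_div_cosh_sq_le_one (x : ℝ) : 1 / Real.cosh x ^ 2 ≤ 1 := by
  rw [div_le_one (pow_pos (Real.cosh_pos x) 2)]
  exact one_le_pow₀ (Real.one_le_cosh x)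

lemma abs_tanh_sub_tanh_le (x y : ℝ) : |Real.tanh x - Real.tanh y| ≤ |x - y| := by
  have := Convex.norm_image_sub_le_of_norm_hasDerivWithin_le (f := Real.tanh)
    (f' := fun x => 1 / Real.cosh x ^ 2) (C := 1) (s := Set.univ) (x := y) (y := x)
    (fun x _ => (hasDerivAt_tanh x).hasDerivWithinAt)
    (fun x _ => by
      rw [Real.norm_of_nonneg (one_div_cosh_sq_pos x).le]; exact one_div_cosh_sq_le_one x)
    convex_univ (Set.mem_univ _) (Set.mem_univ _)
  simpa using this

lemma continuous_tanh : Continuous Real.tanh :=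
  continuous_iff_continuousAt.2 fun x => (hasDerivAt_tanh x).continuousAt

lemma log_cosh_nonneg (x : ℝ) : 0 ≤ Real.log (Real.cosh x) := Real.log_nonneg (Real.one_le_cosh x)

lemma log_cosh_le_abs (x : ℝ) : Real.log (Real.cosh x) ≤ |x| := by
  have := Convex.norm_image_sub_le_of_norm_hasDerivWithin_le
    (f := fun y => Real.log (Real.cosh y))
    (f' := Real.tanh) (C := 1) (s := Set.univ) (x := 0) (y := x)
    (fun x _ => (hasDerivAt_log_cosh x).hasDerivWithinAt)
    (fun x _ => abs_tanh_le_one x)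
    convex_univ (Set.mem_univ _) (Set.mem_univ _)
  simp only [Real.cosh_zero, Real.log_one, sub_zero, one_mul, Real.norm_eq_abs] at this
  exact (le_abs_self _).trans this

/-- Second order upper bound, from `(log cosh)'' ≤ 1`. -/
lemma log_cosh_add_le (y t : ℝ) :
    Real.log (Real.cosh (y + t)) ≤ Real.log (Real.cosh y) + t * Real.tanh y + t ^ 2 / 2 := by
  have key : ∀ y t : ℝ, 0 ≤ t →
      Real.log (Real.cosh (y + t)) ≤ Real.log (Real.cosh y) + t * Real.tanh y + t ^ 2 / 2 := by
    intro y t ht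
    have hd : ∀ s : ℝ, HasDerivAt
        (fun s => s ^ 2 / 2 + s * Real.tanh y - Real.log (Real.cosh (y + s)))
        (s + Real.tanh y - Real.tanh (y + s)) s := by
      intro s
      have h1 := ((hasDerivAt_pow 2 s).div_const 2).add
        ((hasDerivAt_id s).mul_const (Real.tanh y))
      have h2 := (hasDerivAt_log_cosh (y + s)).comp s ((hasDerivAt_id s).const_add y)
      refine (h1.sub h2).congr_deriv ?_
      simp
    have hmono : MonotoneOn
        (fun s => s ^ 2 / 2 + s * Real.tanh y - Real.log (Real.cosh (y + s))) (Set.Ici 0) := by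
      apply monotoneOn_of_deriv_nonneg (convex_Ici 0)
      · exact fun s _ => (hd s).continuousAt.continuousWithinAt
      · exact fun s _ => (hd s).differentiableAt.differentiableWithinAt
      · intro s hs
        rw [interior_Ici, Set.mem_Ioi] at hs
        rw [(hd s).deriv]
        have := (le_abs_self _).trans (abs_tanh_sub_tanh_le (y + s) y)
        rw [add_sub_cancel_left, abs_of_pos hs] at this
        linarith
    have := hmono (Set.mem_Ici.2 le_rfl) (Set.mem_Ici.2 ht) ht
    simp at this
    linarith
  rcases le_total 0 t with ht | ht
  · exact key y t ht
  · have := key (-y) (-t) (by linarith)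
    rw [← neg_add, Real.cosh_neg, Real.cosh_neg, Real.tanh_neg] at this
    linarith

/-! ### Finite volume identities and bounds -/

/-- `n` times the random analogue of `G`. -/
noncomputable def empG (β : ℝ) (h : ℕ → ℝ) (n : ℕ) (x : ℝ) : ℝ :=
  n * (β / 2 * x ^ 2) - ∑ i : Fin n, Real.log (Real.cosh (β * (x + h i)))

/-- The Gibbs weight of a configuration. -/
noncomputable def weight (β : ℝ) (h : ℕ → ℝ) {n : ℕ} (σ : Fin n → ℤˣ) : ℝ :=
  Real.exp (-β * hamiltonian h σ)

lemma weight_pos (β : ℝ) (h : ℕ → ℝ) {n : ℕ} (σ : Fin n → ℤˣ) : 0 < weight β h σ :=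
  Real.exp_pos _

lemma sum_exp_spin (b : ℝ) : ∑ s : ℤˣ, Real.exp (b * ((s : ℤ) : ℝ)) = 2 * Real.cosh b := by
  have hu : (Finset.univ : Finset ℤˣ) = {1, -1} := rfl
  rw [Real.cosh_eq, hu, Finset.sum_pair (by decide)]
  simp only [Units.val_one, Int.cast_one, Units.val_neg, Int.cast_neg, mul_one, mul_neg]
  ring

lemma sum_exp_linear {n : ℕ} (b : Fin n → ℝ) :
    ∑ σ : Fin n → ℤˣ, Real.exp (∑ i, b i * ((σ i : ℤ) : ℝ))
      = 2 ^ n * Real.exp (∑ i, Real.log (Real.cosh (b i))) := by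
  simp_rw [Real.exp_sum, Real.exp_log (Real.cosh_pos _)]
  rw [← Fintype.piFinset_univ,
    ← Finset.prod_univ_sum (fun _ => Finset.univ) (fun i (s : ℤˣ) => Real.exp (b i * ((s : ℤ) : ℝ)))]
  simp_rw [sum_exp_spin]
  rw [Finset.prod_mul_distrib]
  simp

/-- The weight of a configuration through the product measure with external field `x`. -/
lemma weight_eq (β : ℝ) (h : ℕ → ℝ) {n : ℕ} (hn : n ≠ 0) (σ : Fin n → ℤˣ) (x : ℝ) :
    weight β h σ = Real.exp (n * (β / 2) * (magnetization σ / n - x) ^ 2)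
      * (Real.exp (-(n * (β / 2 * x ^ 2)))
        * Real.exp (∑ i : Fin n, β * (x + h i) * ((σ i : ℤ) : ℝ))) := by
  have hn' : (n : ℝ) ≠ 0 := by exact_mod_cast hn
  have h1 : ∑ i : Fin n, ∑ j : Fin n, ((σ i : ℤ) : ℝ) * ((σ j : ℤ) : ℝ)
      = magnetization σ ^ 2 := by
    rw [sq, magnetization, Finset.sum_mul_sum]
  have h2 : ∑ i : Fin n, β * (x + h i) * ((σ i : ℤ) : ℝ)
      = β * x * magnetization σ + β * ∑ i : Fin n, h i * ((σ i : ℤ) : ℝ) := by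
    rw [magnetization, Finset.mul_sum, Finset.mul_sum, ← Finset.sum_add_distrib]
    exact Finset.sum_congr rfl fun i _ => by ring
  rw [weight, hamiltonian, h1, h2, ← Real.exp_add, ← Real.exp_add]
  congr 1
  field_simp
  ring

lemma sum_tilted (β : ℝ) (h : ℕ → ℝ) (n : ℕ) (x : ℝ) :
    ∑ σ : Fin n → ℤˣ, Real.exp (-(n * (β / 2 * x ^ 2)))
        * Real.exp (∑ i : Fin n, β * (x + h i) * ((σ i : ℤ) : ℝ))
      = 2 ^ n * Real.exp (-empG β h n x) := by
  rw [← Finset.mul_sum, sum_exp_linear fun i : Fin n => β * (x + h i), mul_left_comm,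
    ← Real.exp_add, empG]
  congr 2
  ring

/-- For `β > 0` the quadratic factor in `weight_eq` is at least one, so dropping it leaves the mass
of the tilted product measure. -/
lemma partitionFunction_ge {β : ℝ} (hβ : 0 < β) (h : ℕ → ℝ) {n : ℕ} (hn : n ≠ 0) (x : ℝ) :
    2 ^ n * Real.exp (-empG β h n x) ≤ partitionFunction β h n := by
  rw [← sum_tilted, partitionFunction]
  refine Finset.sum_le_sum fun σ _ => ?_
  change _ ≤ weight β h σ
  rw [weight_eq β h hn σ x]
  refine le_mul_of_one_le_left (by positivity) (Real.one_le_exp (by positivity))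

/-- Upper bound for the weight of a set of configurations, where the external field may depend on
the magnetization. -/
lemma sum_weight_le {β : ℝ} (h : ℕ → ℝ) {n : ℕ} (hn : n ≠ 0)
    (A : Finset (Fin n → ℤˣ)) (M : ℝ)
    (hM : ∀ σ ∈ A, ∃ x : ℝ,
      n * (β / 2) * (magnetization σ / n - x) ^ 2 - empG β h n x ≤ M) :
    ∑ σ ∈ A, weight β h σ ≤ (2 * n + 1) * (2 ^ n * Real.exp M) := by
  classical
  set S : (Fin n → ℤˣ) → ℤ := fun σ => ∑ i, (σ i : ℤ) with hS
  have hSm : ∀ σ, magnetization σ = (S σ : ℝ) := fun σ => by simp [hS, magnetization]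
  have hmaps : ∀ σ ∈ A, S σ ∈ Finset.Icc (-(n : ℤ)) n := by
    intro σ _
    rw [Finset.mem_Icc, ← abs_le]
    refine (Finset.abs_sum_le_sum_abs _ _).trans ?_
    simp [Int.isUnit_iff_abs_eq.1 (Units.isUnit _)]
  -- On a level set of the magnetization the quadratic factor of `weight_eq` is constant, so each
  -- level may use its own field `x`.
  rw [← Finset.sum_fiberwise_of_maps_to hmaps]
  have hcard : (2 * (n : ℝ) + 1) = ((Finset.Icc (-(n : ℤ)) n).card : ℝ) := by
    rw [Int.card_Icc]
    have : ((n : ℤ) + 1 - -(n : ℤ)).toNat = 2 * n + 1 := by omega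
    rw [this]; push_cast; ring
  rw [hcard, ← nsmul_eq_mul]
  refine Finset.sum_le_card_nsmul _ _ _ fun s _ => ?_
  rcases (A.filter fun σ => S σ = s).eq_empty_or_nonempty with he | ⟨σ₀, hσ₀⟩
  · rw [he, Finset.sum_empty]; positivity
  · rw [Finset.mem_filter] at hσ₀
    obtain ⟨x, hx⟩ := hM σ₀ hσ₀.1
    calc ∑ σ ∈ A.filter (fun σ => S σ = s), weight β h σ
        = ∑ σ ∈ A.filter (fun σ => S σ = s),
          Real.exp (n * (β / 2) * (magnetization σ₀ / n - x) ^ 2)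
            * (Real.exp (-(n * (β / 2 * x ^ 2)))
            * Real.exp (∑ i : Fin n, β * (x + h i) * ((σ i : ℤ) : ℝ))) := by
          refine Finset.sum_congr rfl fun σ hσ => ?_
          rw [Finset.mem_filter] at hσ
          rw [weight_eq β h hn σ x, hSm σ, hSm σ₀, hσ.2, hσ₀.2]
      _ ≤ ∑ σ : Fin n → ℤˣ,
          Real.exp (n * (β / 2) * (magnetization σ₀ / n - x) ^ 2)
            * (Real.exp (-(n * (β / 2 * x ^ 2)))
            * Real.exp (∑ i : Fin n, β * (x + h i) * ((σ i : ℤ) : ℝ))) :=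
          Finset.sum_le_sum_of_subset_of_nonneg (Finset.subset_univ _)
            fun _ _ _ => by positivity
      _ = 2 ^ n * Real.exp (n * (β / 2) * (magnetization σ₀ / n - x) ^ 2 - empG β h n x) := by
          rw [← Finset.mul_sum, sum_tilted, mul_left_comm, ← Real.exp_add]
          rfl
      _ ≤ 2 ^ n * Real.exp M := by gcongr

/-- Chernoff bound for the tilted product measure, one side. -/
lemma sum_exp_linear_filter_le {n : ℕ} (b : Fin n → ℝ) (t r e : ℝ) (he : e ^ 2 = 1)
    (hrt : t = r * e) (A : Finset (Fin n → ℤˣ))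
    (hA : ∀ σ ∈ A, n * r ≤ e * (magnetization σ - ∑ i, Real.tanh (b i))) (hr : 0 ≤ r) :
    ∑ σ ∈ A, Real.exp (∑ i, b i * ((σ i : ℤ) : ℝ))
      ≤ 2 ^ n * Real.exp (∑ i, Real.log (Real.cosh (b i))) * Real.exp (-(n * r ^ 2 / 2)) := by
  -- Exponential Chebyshev with extra field `t = ± r`: the gain is `n r^2` on `A`, and by
  -- `log_cosh_add_le` the cost is at most `n r^2 / 2`.
  have h1 : ∀ σ ∈ A, Real.exp (∑ i, b i * ((σ i : ℤ) : ℝ)) ≤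
      Real.exp (-(n * r ^ 2) - t * ∑ i, Real.tanh (b i))
        * Real.exp (∑ i, (b i + t) * ((σ i : ℤ) : ℝ)) := by
    intro σ hσ
    rw [← Real.exp_add, Real.exp_le_exp]
    have h2 : ∑ i, (b i + t) * ((σ i : ℤ) : ℝ)
        = ∑ i, b i * ((σ i : ℤ) : ℝ) + t * magnetization σ := by
      rw [magnetization, Finset.mul_sum, ← Finset.sum_add_distrib]
      exact Finset.sum_congr rfl fun i _ => by ring
    rw [h2, hrt]
    have := mul_le_mul_of_nonneg_left (hA σ hσ) hr
    nlinarith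
  calc ∑ σ ∈ A, Real.exp (∑ i, b i * ((σ i : ℤ) : ℝ))
      ≤ ∑ σ ∈ A, Real.exp (-(n * r ^ 2) - t * ∑ i, Real.tanh (b i))
        * Real.exp (∑ i, (b i + t) * ((σ i : ℤ) : ℝ)) := Finset.sum_le_sum h1
    _ ≤ ∑ σ : Fin n → ℤˣ, Real.exp (-(n * r ^ 2) - t * ∑ i, Real.tanh (b i))
        * Real.exp (∑ i, (b i + t) * ((σ i : ℤ) : ℝ)) :=
        Finset.sum_le_sum_of_subset_of_nonneg (Finset.subset_univ _) fun _ _ _ => by positivity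
    _ = 2 ^ n * Real.exp (-(n * r ^ 2) - t * ∑ i, Real.tanh (b i)
          + ∑ i, Real.log (Real.cosh (b i + t))) := by
        rw [← Finset.mul_sum, sum_exp_linear fun i => b i + t, mul_left_comm, ← Real.exp_add]
    _ ≤ 2 ^ n * Real.exp (∑ i, Real.log (Real.cosh (b i)) + -(n * r ^ 2 / 2)) := by
        refine mul_le_mul_of_nonneg_left (Real.exp_le_exp.2 ?_) (by positivity)
        have h3 : ∑ i, Real.log (Real.cosh (b i + t)) ≤
            ∑ i, (Real.log (Real.cosh (b i)) + t * Real.tanh (b i) + t ^ 2 / 2) :=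
          Finset.sum_le_sum fun i _ => log_cosh_add_le _ _
        rw [Finset.sum_add_distrib, Finset.sum_add_distrib, ← Finset.mul_sum] at h3
        simp only [Finset.sum_const, Finset.card_univ, Fintype.card_fin, nsmul_eq_mul] at h3
        have h4 : t ^ 2 = r ^ 2 := by rw [hrt, mul_pow, he, mul_one]
        rw [h4] at h3
        linarith
    _ = _ := by rw [Real.exp_add, mul_assoc]

/-- Under the tilted product measure the magnetization concentrates around its mean. -/
lemma sum_exp_linear_filter_ge {n : ℕ} (b : Fin n → ℝ) (r : ℝ) (hr : 0 ≤ r)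
    (A : Finset (Fin n → ℤˣ))
    (hA : ∀ σ, |magnetization σ - ∑ i, Real.tanh (b i)| < n * r → σ ∈ A) :
    2 ^ n * Real.exp (∑ i, Real.log (Real.cosh (b i))) * (1 - 2 * Real.exp (-(n * r ^ 2 / 2)))
      ≤ ∑ σ ∈ A, Real.exp (∑ i, b i * ((σ i : ℤ) : ℝ)) := by
  classical
  set B := Finset.univ.filter fun σ : Fin n → ℤˣ =>
    n * r ≤ 1 * (magnetization σ - ∑ i, Real.tanh (b i)) with hB
  set C := Finset.univ.filter fun σ : Fin n → ℤˣ =>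
    n * r ≤ -1 * (magnetization σ - ∑ i, Real.tanh (b i)) with hC
  have h1 := sum_exp_linear_filter_le b r r 1 (by norm_num) (by ring) B
    (fun σ hσ => (Finset.mem_filter.1 hσ).2) hr
  have h2 := sum_exp_linear_filter_le b (-r) r (-1) (by norm_num) (by ring) C
    (fun σ hσ => (Finset.mem_filter.1 hσ).2) hr
  have hcover : (Finset.univ : Finset (Fin n → ℤˣ)) ⊆ A ∪ (B ∪ C) := by
    intro σ _
    by_cases hσ : |magnetization σ - ∑ i, Real.tanh (b i)| < n * r
    · exact Finset.mem_union_left _ (hA σ hσ)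
    · refine Finset.mem_union_right _ ?_
      rw [not_lt, le_abs] at hσ
      simp only [hB, hC, Finset.mem_union, Finset.mem_filter, Finset.mem_univ, true_and]
      rcases hσ with hσ | hσ
      · left; linarith
      · right; linarith
  have hpos : ∀ σ : Fin n → ℤˣ, 0 ≤ Real.exp (∑ i, b i * ((σ i : ℤ) : ℝ)) :=
    fun σ => (Real.exp_pos _).le
  have h3 := Finset.sum_le_sum_of_subset_of_nonneg hcover fun σ _ _ => hpos σ
  rw [sum_exp_linear] at h3
  have h4 := Finset.sum_union_inter (s₁ := A) (s₂ := B ∪ C)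
    (f := fun σ => Real.exp (∑ i, b i * ((σ i : ℤ) : ℝ)))
  have h5 := Finset.sum_union_inter (s₁ := B) (s₂ := C)
    (f := fun σ => Real.exp (∑ i, b i * ((σ i : ℤ) : ℝ)))
  have h6 := Finset.sum_nonneg (s := A ∩ (B ∪ C)) fun σ _ => hpos σ
  have h7 := Finset.sum_nonneg (s := B ∩ C) fun σ _ => hpos σ
  linarith

/-- Lower bound for the weight of a set of configurations. -/
lemma sum_weight_ge {β : ℝ} (h : ℕ → ℝ) {n : ℕ} (hn : n ≠ 0) (x r K : ℝ) (hr : 0 ≤ r)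
    (A : Finset (Fin n → ℤˣ))
    (hA : ∀ σ, |magnetization σ - ∑ i : Fin n, Real.tanh (β * (x + h i))| < n * r → σ ∈ A)
    (hK : ∀ σ ∈ A, K ≤ n * (β / 2) * (magnetization σ / n - x) ^ 2) :
    2 ^ n * Real.exp (K - empG β h n x) * (1 - 2 * Real.exp (-(n * r ^ 2 / 2)))
      ≤ ∑ σ ∈ A, weight β h σ := by
  have h1 := sum_exp_linear_filter_ge (fun i : Fin n => β * (x + h i)) r hr A hA
  calc _ = Real.exp K * Real.exp (-(n * (β / 2 * x ^ 2))) *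
        (2 ^ n * Real.exp (∑ i : Fin n, Real.log (Real.cosh (β * (x + h i))))
          * (1 - 2 * Real.exp (-(n * r ^ 2 / 2)))) := by
        have : K - empG β h n x = K + -(n * (β / 2 * x ^ 2))
          + ∑ i : Fin n, Real.log (Real.cosh (β * (x + h i))) := by rw [empG]; ring
        rw [this, Real.exp_add, Real.exp_add]; ring
    _ ≤ Real.exp K * Real.exp (-(n * (β / 2 * x ^ 2))) *
        ∑ σ ∈ A, Real.exp (∑ i : Fin n, β * (x + h i) * ((σ i : ℤ) : ℝ)) := by gcongr
    _ ≤ _ := by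
        rw [Finset.mul_sum]
        refine Finset.sum_le_sum fun σ hσ => ?_
        rw [weight_eq β h hn σ x, mul_assoc]
        gcongr
        exact hK σ hσ

/-! ### The law of the rescaled magnetization -/

lemma measurable_magnetization (n : ℕ) :
    Measurable (magnetization : (Fin n → ℤˣ) → ℝ) := by
  unfold magnetization
  refine Finset.measurable_sum _ fun i _ => ?_
  have h1 : Measurable (Units.val : ℤˣ → ℤ) := comap_measurable _
  have h2 : Measurable (fun z : ℤ => (z : ℝ)) := measurable_from_top
  exact h2.comp (h1.comp (measurable_pi_apply i))

open Classical in
lemma scaledMagnetizationLaw_apply (β : ℝ) (h : ℕ → ℝ) (m α : ℝ) (n : ℕ) {C : Set ℝ}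
    (hC : MeasurableSet C) :
    scaledMagnetizationLaw β h m α n C = ENNReal.ofReal
      ((∑ σ : Fin n → ℤˣ with (magnetization σ - n * m) / (n : ℝ) ^ α ∈ C, weight β h σ)
        / partitionFunction β h n) := by
  have hmeas : Measurable fun σ : Fin n → ℤˣ => (magnetization σ - n * m) / (n : ℝ) ^ α :=
    ((measurable_magnetization n).sub_const _).div_const _
  have hZ : 0 ≤ partitionFunction β h n := Finset.sum_nonneg fun _ _ => (Real.exp_pos _).le
  rw [scaledMagnetizationLaw, Measure.map_apply hmeas hC, gibbsMeasure, Measure.finsetSum_apply,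
    Finset.sum_div, ENNReal.ofReal_sum_of_nonneg
      (fun σ _ => div_nonneg (weight_pos β h σ).le hZ), Finset.sum_filter]
  refine Finset.sum_congr rfl fun σ _ => ?_
  rw [Measure.smul_apply, Measure.dirac_apply' _ (hmeas hC), Set.indicator_apply]
  simp only [Set.mem_preimage, Pi.one_apply, smul_eq_mul, mul_ite, mul_one, mul_zero, weight]

/-! ### The function `G` and its first two derivatives -/

/-- The derivative of `G`. -/
noncomputable def derivG (β : ℝ) (ν : Measure ℝ) (x : ℝ) : ℝ :=
  β * x - β * ∫ h, Real.tanh (β * (x + h)) ∂ν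

/-- The second derivative of `G`. -/
noncomputable def curvature (β : ℝ) (ν : Measure ℝ) (x : ℝ) : ℝ :=
  β - β ^ 2 * ∫ h, 1 / Real.cosh (β * (x + h)) ^ 2 ∂ν

section
variable {β : ℝ} {ν : Measure ℝ}

lemma isMin_of_pure {m : ℝ} (hm : IsPureCenteredAt β ν m) (x : ℝ) : G β ν m ≤ G β ν x := by
  have : m ∈ {x : ℝ | IsMinOn (G β ν) Set.univ x} := by
    rw [show {x : ℝ | IsMinOn (G β ν) Set.univ x} = {m} from hm]; rfl
  exact this (Set.mem_univ x)

lemma lt_of_pure {m : ℝ} (hm : IsPureCenteredAt β ν m) {x : ℝ} (hx : x ≠ m) :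
    G β ν m < G β ν x := by
  refine lt_of_le_of_ne (isMin_of_pure hm x) fun he => hx ?_
  have : x ∈ {x : ℝ | IsMinOn (G β ν) Set.univ x} := fun y _ => by
    change G β ν x ≤ G β ν y
    rw [← he]; exact isMin_of_pure hm y
  rw [show {x : ℝ | IsMinOn (G β ν) Set.univ x} = {m} from hm] at this
  exact this

variable [IsProbabilityMeasure ν]

lemma continuous_tanh_shift (β x : ℝ) : Continuous fun h : ℝ => Real.tanh (β * (x + h)) :=
  continuous_tanh.comp (by fun_prop)

lemma continuous_one_div_cosh_sq (β x : ℝ) :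
    Continuous fun h : ℝ => 1 / Real.cosh (β * (x + h)) ^ 2 := by
  refine Continuous.div continuous_const (by fun_prop) fun h => ?_
  exact (pow_pos (Real.cosh_pos _) 2).ne'

lemma continuous_log_cosh (β x : ℝ) :
    Continuous fun h : ℝ => Real.log (Real.cosh (β * (x + h))) :=
  Continuous.log (by fun_prop) fun h => (Real.cosh_pos _).ne'

lemma integrable_tanh_shift (x : ℝ) : Integrable (fun h : ℝ => Real.tanh (β * (x + h))) ν :=
  Integrable.of_bound (continuous_tanh_shift β x).aestronglyMeasurable 1
    (ae_of_all _ fun _ => abs_tanh_le_one _)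

lemma integrable_one_div_cosh_sq (x : ℝ) :
    Integrable (fun h : ℝ => 1 / Real.cosh (β * (x + h)) ^ 2) ν :=
  Integrable.of_bound (continuous_one_div_cosh_sq β x).aestronglyMeasurable 1
    (ae_of_all _ fun _ => by
      rw [Real.norm_of_nonneg (one_div_cosh_sq_pos _).le]; exact one_div_cosh_sq_le_one _)

lemma integrable_log_cosh (hν : Integrable (fun x : ℝ => x ^ 2) ν) (x : ℝ) :
    Integrable (fun h : ℝ => Real.log (Real.cosh (β * (x + h)))) ν := by
  refine Integrable.mono' (g := fun h : ℝ => |β| * (|x| + 1 + h ^ 2))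
    (((integrable_const _).add hν).const_mul _)
    (continuous_log_cosh β x).aestronglyMeasurable (ae_of_all _ fun h => ?_)
  rw [Real.norm_of_nonneg (log_cosh_nonneg _)]
  refine (log_cosh_le_abs _).trans ?_
  rw [abs_mul]
  have h1 : |h| ≤ 1 + h ^ 2 := by
    rw [← sq_abs]; nlinarith [sq_nonneg (|h| - 1), abs_nonneg h]
  have h2 := abs_add_le x h
  gcongr
  linarith

lemma hasDerivAt_G (hν : Integrable (fun x : ℝ => x ^ 2) ν) (x : ℝ) :
    HasDerivAt (G β ν) (derivG β ν x) x := by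
  have hd : ∀ h y : ℝ, HasDerivAt (fun y => Real.log (Real.cosh (β * (y + h))))
      (Real.tanh (β * (y + h)) * β) y := by
    intro h y
    have h1 : HasDerivAt (fun y : ℝ => β * (y + h)) β y := by
      simpa using ((hasDerivAt_id y).add_const h).const_mul β
    exact (hasDerivAt_log_cosh _).comp y h1
  have h1 := (hasDerivAt_integral_of_dominated_loc_of_deriv_le (μ := ν)
    (F := fun y h => Real.log (Real.cosh (β * (y + h))))
    (F' := fun y h => Real.tanh (β * (y + h)) * β) (x₀ := x) (s := Set.univ)
    (bound := fun _ => |β|) univ_mem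
    (Eventually.of_forall fun y => (continuous_log_cosh β y).aestronglyMeasurable)
    (integrable_log_cosh hν x)
    ((continuous_tanh_shift β x).mul_const β).aestronglyMeasurable
    (ae_of_all _ fun h y _ => by
      rw [norm_mul]
      exact mul_le_of_le_one_left (abs_nonneg _) (abs_tanh_le_one _))
    (integrable_const _) (ae_of_all _ fun h y _ => hd h y)).2
  have h2 : HasDerivAt (fun y : ℝ => β / 2 * y ^ 2) (β * x) x := by
    refine ((hasDerivAt_pow 2 x).const_mul (β / 2)).congr_deriv ?_
    simp; ring
  refine (h2.sub h1).congr_deriv ?_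
  rw [derivG, integral_mul_const, mul_comm β (∫ _, _ ∂ν)]

lemma hasDerivAt_derivG (x : ℝ) : HasDerivAt (derivG β ν) (curvature β ν x) x := by
  have hd : ∀ h y : ℝ, HasDerivAt (fun y => Real.tanh (β * (y + h)))
      (1 / Real.cosh (β * (y + h)) ^ 2 * β) y := by
    intro h y
    have h1 : HasDerivAt (fun y : ℝ => β * (y + h)) β y := by
      simpa using ((hasDerivAt_id y).add_const h).const_mul β
    exact (hasDerivAt_tanh _).comp y h1
  have h1 := (hasDerivAt_integral_of_dominated_loc_of_deriv_le (μ := ν)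
    (F := fun y h => Real.tanh (β * (y + h)))
    (F' := fun y h => 1 / Real.cosh (β * (y + h)) ^ 2 * β) (x₀ := x) (s := Set.univ)
    (bound := fun _ => |β|) univ_mem
    (Eventually.of_forall fun y => (continuous_tanh_shift β y).aestronglyMeasurable)
    (integrable_tanh_shift x)
    ((continuous_one_div_cosh_sq β x).mul_const β).aestronglyMeasurable
    (ae_of_all _ fun h y _ => by
      rw [norm_mul, Real.norm_of_nonneg (one_div_cosh_sq_pos _).le]
      exact mul_le_of_le_one_left (abs_nonneg _) (one_div_cosh_sq_le_one _))
    (integrable_const _) (ae_of_all _ fun h y _ => hd h y)).2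
  have h2 : HasDerivAt (fun y : ℝ => β * y) β x := by
    simpa using (hasDerivAt_id x).const_mul β
  refine (h2.sub (h1.const_mul β)).congr_deriv ?_
  rw [curvature, integral_mul_const]
  ring

/-- Strict positivity of `1 / cosh^2` gives the gap. It makes `β / (β - curvature)` a positive
constant and, for type one, forces `lam < β`, so that the variance in the rate function is positive.
-/
lemma curvature_lt (hβ : 0 < β) (x : ℝ) : curvature β ν x < β := by
  have h1 : 0 < ∫ h, 1 / Real.cosh (β * (x + h)) ^ 2 ∂ν := by
    rw [integral_pos_iff_support_of_nonneg (fun h => (one_div_cosh_sq_pos _).le)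
      (integrable_one_div_cosh_sq x)]
    have : Function.support (fun h : ℝ => 1 / Real.cosh (β * (x + h)) ^ 2) = Set.univ :=
      Set.eq_univ_of_forall fun h => (one_div_cosh_sq_pos _).ne'
    rw [this]
    simp
  rw [curvature]
  nlinarith [mul_pos (pow_pos hβ 2) h1]

lemma derivG_eq_zero (hν : Integrable (fun x : ℝ => x ^ 2) ν) {m : ℝ}
    (hm : IsPureCenteredAt β ν m) : derivG β ν m = 0 :=
  IsLocalMin.hasDerivAt_eq_zero (Eventually.of_forall fun x => isMin_of_pure hm x)
    (hasDerivAt_G hν m)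

lemma derivG_isLittleO (hν : Integrable (fun x : ℝ => x ^ 2) ν) {m : ℝ}
    (hm : IsPureCenteredAt β ν m) :
    (fun x => derivG β ν x - curvature β ν m * (x - m)) =o[𝓝 m] fun x => x - m := by
  have := (hasDerivAt_derivG (β := β) (ν := ν) m).isLittleO
  simpa [derivG_eq_zero hν hm, mul_comm] using this

/-- Second order Taylor expansion with Peano remainder at the minimizer. -/
lemma G_isLittleO (hν : Integrable (fun x : ℝ => x ^ 2) ν) {m : ℝ}
    (hm : IsPureCenteredAt β ν m) :
    (fun x => G β ν x - G β ν m - curvature β ν m / 2 * (x - m) ^ 2) =o[𝓝 m]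
      fun x => (x - m) ^ 2 := by
  rw [isLittleO_iff]
  intro ε hε
  obtain ⟨δ, hδ, hb⟩ := Metric.eventually_nhds_iff.1
    ((isLittleO_iff.1 (derivG_isLittleO hν hm)) hε)
  refine Metric.eventually_nhds_iff.2 ⟨δ, hδ, fun {x} hx => ?_⟩
  have hd : ∀ y : ℝ, HasDerivAt (fun x => G β ν x - G β ν m - curvature β ν m / 2 * (x - m) ^ 2)
      (derivG β ν y - curvature β ν m * (y - m)) y := by
    intro y
    have h1 := (((hasDerivAt_id y).sub_const m).pow 2).const_mul (curvature β ν m / 2)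
    refine (((hasDerivAt_G hν y).sub_const (G β ν m)).sub h1).congr_deriv ?_
    simp
    ring
  have hsub : ∀ y ∈ Set.uIcc m x, |y - m| ≤ |x - m| := fun y hy => Set.abs_sub_left_of_mem_uIcc hy
  have := Convex.norm_image_sub_le_of_norm_hasDerivWithin_le (C := ε * |x - m|)
    (s := Set.uIcc m x) (x := m) (y := x) (fun y _ => (hd y).hasDerivWithinAt)
    (fun y hy => (hb (y := y) (by
        rw [Real.dist_eq] at hx ⊢; exact (hsub y hy).trans_lt hx)).trans (by
        rw [Real.norm_eq_abs]
        exact mul_le_mul_of_nonneg_left (hsub y hy) hε.le))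
    (convex_uIcc m x) Set.left_mem_uIcc Set.right_mem_uIcc
  simp only [sub_self, ne_eq, OfNat.ofNat_ne_zero, not_false_eq_true, zero_pow, mul_zero,
    sub_zero] at this
  refine this.trans_eq ?_
  rw [norm_pow, Real.norm_eq_abs]
  ring

lemma isLittleO_pow_sub {m : ℝ} {p q : ℕ} (hpq : p < q) :
    (fun x : ℝ => (x - m) ^ q) =o[𝓝 m] fun x => (x - m) ^ p := by
  have h1 : Tendsto (fun x : ℝ => x - m) (𝓝 m) (𝓝 0) := by
    simpa using (continuous_id.sub continuous_const).tendsto (f := fun x : ℝ => x - m) m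
  exact (isLittleO_pow_pow hpq).comp_tendsto h1

lemma eq_zero_of_const_mul_isLittleO {a m : ℝ}
    (h : (fun x : ℝ => a * (x - m) ^ 2) =o[𝓝 m] fun x => (x - m) ^ 2) : a = 0 := by
  by_contra ha
  have h2 : (fun x : ℝ => (x - m) ^ 2) =o[𝓝 m] fun x => (x - m) ^ 2 :=
    (isLittleO_const_mul_left_iff ha).1 h
  obtain ⟨δ, hδ, hb⟩ := Metric.eventually_nhds_iff.1 (isLittleO_iff.1 h2 (c := 1 / 2) (by norm_num))
  have := hb (y := m + δ / 2) (by rw [Real.dist_eq]; rw [add_sub_cancel_left, abs_of_pos (by linarith)]; linarith)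
  rw [add_sub_cancel_left, norm_pow, Real.norm_of_nonneg (by positivity)] at this
  nlinarith [pow_pos (half_pos hδ) 2]

/-- The curvature at the minimizer is the strength for type one, and vanishes otherwise. -/
lemma curvature_eq (hν : Integrable (fun x : ℝ => x ^ 2) ν) {m : ℝ}
    (hm : IsPureCenteredAt β ν m) {k : ℕ} {lam : ℝ} (hk : HasTypeStrength β ν m k lam) :
    curvature β ν m = if k = 1 then lam else 0 := by
  have h1 := G_isLittleO hν hm
  have hk1 := hk.one_le_type
  have h2 : (fun x : ℝ => G β ν x - (G β ν m + lam / ((2 * k).factorial : ℝ) * (x - m) ^ (2 * k)))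
      =o[𝓝 m] fun x => (x - m) ^ 2 := hk.expansion.trans_isLittleO (isLittleO_pow_sub (by omega))
  -- Subtracting the two expansions of `G` leaves a multiple of `(x - m)^2`, up to the higher power
  -- when `k ≠ 1`, which is `o((x - m)^2)`; the multiple must vanish.
  have h3 := h2.sub h1
  split_ifs with hk2
  · subst hk2
    have h4 : curvature β ν m / 2 - lam / 2 = 0 := by
      apply eq_zero_of_const_mul_isLittleO (m := m)
      refine h3.congr_left fun x => ?_
      simp [Nat.factorial]
      ring
    linarith
  · have h4 : (fun x : ℝ => lam / ((2 * k).factorial : ℝ) * (x - m) ^ (2 * k)) =o[𝓝 m]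
        fun x => (x - m) ^ 2 := (isLittleO_pow_sub (by omega)).const_mul_left _
    have h5 : curvature β ν m / 2 = 0 := by
      apply eq_zero_of_const_mul_isLittleO (m := m)
      refine (h3.add h4).congr_left fun x => ?_
      ring
    linarith

/-- Away from the minimizer `G` is bounded below by a multiple of any even power. -/
lemma exists_lower_bound (hν : Integrable (fun x : ℝ => x ^ 2) ν) {m : ℝ}
    (hm : IsPureCenteredAt β ν m) (k : ℕ) {δ : ℝ} (hδ : 0 < δ) (R : ℝ) :
    ∃ κ > 0, ∀ w : ℝ, δ ≤ |w| → |w| ≤ R → κ * w ^ (2 * k) ≤ G β ν (m + w) - G β ν m := by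
  set K : Set ℝ := {w | δ ≤ |w| ∧ |w| ≤ R} with hK
  have hcont : Continuous fun w => G β ν (m + w) - G β ν m := by
    have : Continuous (G β ν) :=
      continuous_iff_continuousAt.2 fun x => (hasDerivAt_G hν x).continuousAt
    fun_prop
  have hKc : IsCompact K := by
    refine (isCompact_closedBall (0 : ℝ) R).of_isClosed_subset ?_ fun w hw => ?_
    · exact (isClosed_le continuous_const continuous_abs).inter
        (isClosed_le continuous_abs continuous_const)
    · simpa [Real.dist_eq] using hw.2
  rcases K.eq_empty_or_nonempty with he | hne
  · refine ⟨1, one_pos, fun w h1 h2 => ?_⟩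
    have : w ∈ K := ⟨h1, h2⟩
    simp [he] at this
  · obtain ⟨w₀, hw₀, hmin⟩ := hKc.exists_isMinOn hne hcont.continuousOn
    have hpos : 0 < G β ν (m + w₀) - G β ν m := by
      refine sub_pos.2 (lt_of_pure hm fun h => ?_)
      have h0 : w₀ = 0 := by linarith
      have := hw₀.1
      rw [h0, abs_zero] at this
      linarith
    have hR : 0 ≤ R := (abs_nonneg _).trans hw₀.2
    refine ⟨(G β ν (m + w₀) - G β ν m) / (R ^ (2 * k) + 1), by positivity, fun w h1 h2 => ?_⟩
    have h3 : G β ν (m + w₀) - G β ν m ≤ G β ν (m + w) - G β ν m := hmin ⟨h1, h2⟩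
    refine le_trans ?_ h3
    rw [div_mul_eq_mul_div, div_le_iff₀ (by positivity)]
    gcongr
    rw [← (even_two_mul k).pow_abs]
    have := pow_le_pow_left₀ (abs_nonneg w) h2 (2 * k)
    linarith

/-- The local structure of `G` at its minimizer in the variables of the moderate deviations
principle: `c` relates a magnetization `m + w` to the optimal external field `m + c w`, and `A` is
the coefficient of the rate function. -/
lemma exists_local_expansion (hβ : 0 < β) (hν : Integrable (fun x : ℝ => x ^ 2) ν) {m : ℝ}
    (hm : IsPureCenteredAt β ν m) {k : ℕ} {lam : ℝ} (hk : HasTypeStrength β ν m k lam) :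
    ∃ c A : ℝ, 0 < c ∧ 0 < A ∧ (k = 1 ∨ c = 1) ∧
      (∀ y, rateFunction β k lam y = A * y ^ (2 * k)) ∧
      ((fun w => β / 2 * ((1 - c) * w) ^ 2 - (G β ν (m + c * w) - G β ν m) + A * w ^ (2 * k))
        =o[𝓝 0] fun w => w ^ (2 * k)) ∧
      ((fun w => c * w - derivG β ν (m + c * w) / β - w) =o[𝓝 0] fun w => w) := by
  have hlam := hk.strength_pos
  have hk1 := hk.one_le_type
  have hcurv := curvature_eq hν hm hk
  have hlt : curvature β ν m < β := curvature_lt hβ m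
  have hpos : 0 < β - curvature β ν m := by linarith
  -- Linearizing `x - G' x / β = m + w` at `x = m + c w` gives `c (1 - curvature / β) = 1`.
  set c : ℝ := β / (β - curvature β ν m) with hc
  have hc0 : 0 < c := div_pos hβ hpos
  have htend : Tendsto (fun w : ℝ => m + c * w) (𝓝 0) (𝓝 m) := by
    have : Continuous fun w : ℝ => m + c * w := by fun_prop
    simpa using this.tendsto 0
  have hder : (fun w => c * w - derivG β ν (m + c * w) / β - w) =o[𝓝 0] fun w => w := by
    have h1 := (derivG_isLittleO hν hm).comp_tendsto htend
    have h2 : (fun w : ℝ => -(1 / β) *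
        (derivG β ν (m + c * w) - curvature β ν m * (m + c * w - m))) =o[𝓝 0] fun w => w := by
      refine IsLittleO.const_mul_left (h1.trans_isBigO ?_) _
      refine (isBigO_const_mul_self c (fun w : ℝ => w) (𝓝 0)).congr_left fun w => ?_
      simp
    refine h2.congr_left fun w => ?_
    have h3 : c * (β - curvature β ν m) = β := by rw [hc]; field_simp
    field_simp
    linear_combination (-w) * h3
  have hexp : (fun w => G β ν (m + c * w) -
      (G β ν m + lam / ((2 * k).factorial : ℝ) * (c * w) ^ (2 * k))) =o[𝓝 0]
      fun w => w ^ (2 * k) := by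
    have h1 := hk.expansion.comp_tendsto htend
    have h2 : (fun w : ℝ => (m + c * w - m) ^ (2 * k + 1)) =o[𝓝 0] fun w => w ^ (2 * k) := by
      have h3 : (fun w : ℝ => c ^ (2 * k + 1) * w ^ (2 * k + 1)) =o[𝓝 0] fun w => w ^ (2 * k) :=
        (isLittleO_pow_pow (by omega)).const_mul_left _
      refine h3.congr_left fun w => ?_
      rw [add_sub_cancel_left, mul_pow]
    refine (h1.trans_isLittleO h2).congr_left fun w => ?_
    simp
  by_cases hk2 : k = 1
  · subst hk2
    rw [if_pos rfl] at hcurv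
    rw [hcurv] at hc hlt hpos
    have hinv : 0 < lam⁻¹ - β⁻¹ := sub_pos.2 (inv_strictAnti₀ hlam hlt)
    refine ⟨c, 1 / (2 * (lam⁻¹ - β⁻¹)), hc0, by positivity, Or.inl rfl, fun y => ?_, ?_, hder⟩
    · rw [rateFunction, if_pos rfl]; ring
    · refine hexp.neg_left.congr_left fun w => ?_
      -- With `c = β / (β - lam)`, the coefficient `β (1 - c)^2 / 2 - lam c^2 / 2` equals `-lam β /
      -- (2 (β - lam))`.
      have h4 : 1 / (2 * (lam⁻¹ - β⁻¹)) = lam * β / (2 * (β - lam)) := by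
        rw [inv_sub_inv hlam.ne' hβ.ne']
        field_simp
      rw [h4, hc]
      simp only [Nat.factorial, mul_one]
      field_simp
      push_cast
      ring
  · rw [if_neg hk2] at hcurv
    -- Zero curvature makes the field and the magnetization agree to first order: the quadratic term
    -- disappears and the rate is the Taylor term of `G`.
    have hc1 : c = 1 := by rw [hc, hcurv, sub_zero, div_self hβ.ne']
    refine ⟨c, lam / ((2 * k).factorial : ℝ), hc0, by positivity, Or.inr hc1, fun y => ?_, ?_,
      hder⟩
    · rw [rateFunction, if_neg hk2]; ring
    · refine hexp.neg_left.congr_left fun w => ?_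
      rw [hc1]
      ring

end

/-! ### Almost sure uniform control of the random fluctuations -/

section
variable {β : ℝ} {ν : Measure ℝ} [IsProbabilityMeasure ν]

lemma iIndepFun_tanh (x : ℝ) : ProbabilityTheory.iIndepFun
    (fun (i : ℕ) (h : ℕ → ℝ) => Real.tanh (β * (x + h i)) - ∫ y, Real.tanh (β * (x + y)) ∂ν)
    (Measure.infinitePi fun _ : ℕ => ν) :=
  ProbabilityTheory.iIndepFun_infinitePi (P := fun _ : ℕ => ν)
    (X := fun _ y => Real.tanh (β * (x + y)) - ∫ y, Real.tanh (β * (x + y)) ∂ν)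
    fun _ => (continuous_tanh_shift β x).measurable.sub_const _

/-- Hoeffding's lemma for values in `[-1, 1]`, an interval of half-length one, carried from `ν` to a
coordinate of the product. -/
lemma hasSubgaussianMGF_tanh (x : ℝ) (i : ℕ) : ProbabilityTheory.HasSubgaussianMGF
    (fun h : ℕ → ℝ => Real.tanh (β * (x + h i)) - ∫ y, Real.tanh (β * (x + y)) ∂ν) 1
    (Measure.infinitePi fun _ : ℕ => ν) := by
  have hmp := measurePreserving_eval_infinitePi (fun _ : ℕ => ν) i
  have h1 := ProbabilityTheory.hasSubgaussianMGF_of_mem_Icc (a := -1) (b := 1) (μ := ν)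
    (X := fun y => Real.tanh (β * (x + y))) (continuous_tanh_shift β x).measurable.aemeasurable
    (ae_of_all _ fun y => abs_le.1 (abs_tanh_le_one _))
  have hc : (‖(1 : ℝ) - -1‖₊ / 2) ^ 2 = 1 := by
    have : ‖(1 : ℝ) - -1‖₊ = 2 := by
      rw [sub_neg_eq_add, one_add_one_eq_two]; exact Real.nnnorm_two
    rw [this, div_self two_ne_zero, one_pow]
  rw [hc, ← hmp.map_eq] at h1
  have := ProbabilityTheory.HasSubgaussianMGF.of_map (hmp.measurable.aemeasurable) h1
  rw [hmp.map_eq] at this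
  exact this

/-- Two-sided Hoeffding bound for the empirical mean of `tanh`. -/
lemma measure_abs_sum_tanh_ge_le (x : ℝ) (n : ℕ) {e : ℝ} (he : 0 ≤ e) :
    (Measure.infinitePi fun _ : ℕ => ν) {h | e ≤ |∑ i ∈ Finset.range n,
        (Real.tanh (β * (x + h i)) - ∫ y, Real.tanh (β * (x + y)) ∂ν)|}
      ≤ ENNReal.ofReal (2 * Real.exp (-e ^ 2 / (2 * n))) := by
  have h1 := ProbabilityTheory.HasSubgaussianMGF.measure_sum_range_ge_le_of_iIndepFun
    (iIndepFun_tanh (β := β) (ν := ν) x) (n := n) (fun i _ => hasSubgaussianMGF_tanh x i) he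
  have h2 := ProbabilityTheory.HasSubgaussianMGF.measure_sum_range_ge_le_of_iIndepFun
    ((iIndepFun_tanh (β := β) (ν := ν) x).comp (fun _ y => -y) fun _ => measurable_neg) (n := n)
    (fun i _ => (hasSubgaussianMGF_tanh x i).neg) he
  simp only [NNReal.coe_one, mul_one] at h1 h2
  have hsub : {h : ℕ → ℝ | e ≤ |∑ i ∈ Finset.range n,
        (Real.tanh (β * (x + h i)) - ∫ y, Real.tanh (β * (x + y)) ∂ν)|} ⊆
      {h | e ≤ ∑ i ∈ Finset.range n,
        (Real.tanh (β * (x + h i)) - ∫ y, Real.tanh (β * (x + y)) ∂ν)} ∪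
      {h | e ≤ ∑ i ∈ Finset.range n, ((fun y => -y) ∘ fun h : ℕ → ℝ =>
        (Real.tanh (β * (x + h i)) - ∫ y, Real.tanh (β * (x + y)) ∂ν)) h} := by
    intro h hh
    rw [Set.mem_ofPred_eq, le_abs] at hh
    rcases hh with hh | hh
    · exact Or.inl hh
    · right
      simpa only [Set.mem_ofPred_eq, Function.comp_apply, Finset.sum_neg_distrib] using hh
  rw [← ofReal_measureReal]
  refine ENNReal.ofReal_le_ofReal ?_
  refine (measureReal_mono hsub).trans ((measureReal_union_le _ _).trans ?_)
  linarith

lemma summable_polynomial_mul_exp_neg_rpow (a : ℝ) {e : ℝ} (he : 0 < e) :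
    Summable fun n : ℕ => (a * n + 1) * (2 * Real.exp (-(n : ℝ) ^ e / 2)) := by
  have h1 : Tendsto (fun n : ℕ => (n : ℝ) ^ e) atTop atTop :=
    (tendsto_rpow_atTop he).comp tendsto_natCast_atTop_atTop
  -- The power `-3 / e` of `n ^ e` is `n ^ (-3)`; after the linear factor a summable `n ^ (-2)`
  -- remains.
  have h2 := ((isLittleO_exp_neg_mul_rpow_atTop (a := 1 / 2) (by norm_num)
    (-3 / e)).comp_tendsto h1).isBigO
  have h3 : (fun n : ℕ => a * n + 1) =O[atTop] fun n : ℕ => (n : ℝ) := by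
    refine (isBigO_const_mul_self a (fun n : ℕ => (n : ℝ)) atTop).add ?_
    refine IsBigO.of_bound 1 ?_
    filter_upwards [eventually_ge_atTop 1] with n hn
    simpa using hn
  have h4 := h3.mul (h2.const_mul_left 2)
  refine summable_of_isBigO_nat (g := fun n : ℕ => (n : ℝ) ^ (-2 : ℝ))
    (Real.summable_nat_rpow.2 (by norm_num)) ?_
  refine (h4.congr_left fun n => ?_).trans (EventuallyEq.isBigO ?_)
  · simp only [Function.comp_apply]
    congr 3
    ring
  · filter_upwards [eventually_gt_atTop 0] with n hn
    have hn' : (0 : ℝ) < n := by exact_mod_cast hn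
    rw [Function.comp_apply, ← Real.rpow_mul hn'.le, mul_div_cancel₀ _ he.ne']
    nth_rewrite 1 [← Real.rpow_one (n : ℝ)]
    rw [← Real.rpow_add hn']
    norm_num

/-- Each summand and its mean are `|β|`-Lipschitz in `x`; this is the cost of moving `x` to a grid
point. -/
lemma abs_sum_tanh_sub_le (h : ℕ → ℝ) (n : ℕ) (x y : ℝ) :
    |∑ i ∈ Finset.range n, (Real.tanh (β * (x + h i)) - ∫ z, Real.tanh (β * (x + z)) ∂ν)|
      ≤ |∑ i ∈ Finset.range n, (Real.tanh (β * (y + h i)) - ∫ z, Real.tanh (β * (y + z)) ∂ν)|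
        + n * (2 * (|β| * |x - y|)) := by
  have hpt : ∀ z : ℝ, |Real.tanh (β * (x + z)) - Real.tanh (β * (y + z))| ≤ |β| * |x - y| := by
    intro z
    refine (abs_tanh_sub_tanh_le _ _).trans_eq ?_
    rw [← abs_mul]; congr 1; ring
  have hint : |∫ z, Real.tanh (β * (x + z)) ∂ν - ∫ z, Real.tanh (β * (y + z)) ∂ν|
      ≤ |β| * |x - y| := by
    rw [← integral_sub (integrable_tanh_shift x) (integrable_tanh_shift y)]
    have := norm_integral_le_of_norm_le_const (μ := ν) (C := |β| * |x - y|)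
      (f := fun z => Real.tanh (β * (x + z)) - Real.tanh (β * (y + z)))
      (ae_of_all _ hpt)
    simpa using this
  have hterm : ∀ i ∈ Finset.range n,
      |(Real.tanh (β * (x + h i)) - ∫ z, Real.tanh (β * (x + z)) ∂ν)
        - (Real.tanh (β * (y + h i)) - ∫ z, Real.tanh (β * (y + z)) ∂ν)|
      ≤ 2 * (|β| * |x - y|) := by
    intro i _
    rw [sub_sub_sub_comm]
    refine (abs_sub _ _).trans ?_
    linarith [hpt (h i)]
  have hsum := (Finset.abs_sum_le_sum_abs _ _).trans (Finset.sum_le_card_nsmul _ _ _ hterm)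
  rw [Finset.sum_sub_distrib, Finset.card_range, nsmul_eq_mul] at hsum
  have := abs_sub_abs_le_abs_sub
    (∑ i ∈ Finset.range n, (Real.tanh (β * (x + h i)) - ∫ z, Real.tanh (β * (x + z)) ∂ν))
    (∑ i ∈ Finset.range n, (Real.tanh (β * (y + h i)) - ∫ z, Real.tanh (β * (y + z)) ∂ν))
  linarith

/-- Borel–Cantelli over the `2 R n + 1` points of a grid of mesh `1 / n` in `[-R, R]`. The union
bound loses only a linear factor, and this mesh keeps the discretization error at `2 |β|`. -/
lemma ae_eventually_abs_sum_tanh_le_add (R : ℕ) {e : ℝ} (he : 0 < e) :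
    ∀ᵐ h ∂(Measure.infinitePi fun _ : ℕ => ν), ∀ᶠ n : ℕ in atTop, ∀ x : ℝ, |x| ≤ R →
      |∑ i ∈ Finset.range n, (Real.tanh (β * (x + h i)) - ∫ z, Real.tanh (β * (x + z)) ∂ν)|
        ≤ (n : ℝ) ^ (1 / 2 + e) + 2 * |β| := by
  set s : ℕ → Set (ℕ → ℝ) := fun n => ⋃ j ∈ Finset.range (2 * R * n + 1),
    {h | (n : ℝ) ^ (1 / 2 + e) ≤ |∑ i ∈ Finset.range n,
        (Real.tanh (β * (((j : ℝ) / n - R) + h i))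
          - ∫ y, Real.tanh (β * (((j : ℝ) / n - R) + y)) ∂ν)|} with hs
  have hbound : ∀ n, (Measure.infinitePi fun _ : ℕ => ν) (s n) ≤
      ENNReal.ofReal (((2 * R : ℝ) * n + 1) * (2 * Real.exp (-(n : ℝ) ^ (2 * e) / 2))) := by
    intro n
    refine (measure_biUnion_finset_le _ _).trans ?_
    refine (Finset.sum_le_card_nsmul _ _ _ fun (j : ℕ) _ =>
      measure_abs_sum_tanh_ge_le (β := β) (ν := ν) ((j : ℝ) / n - R) n
        (e := (n : ℝ) ^ (1 / 2 + e)) (by positivity)).trans ?_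
    rw [Finset.card_range, nsmul_eq_mul]
    have h1 : ((2 * R * n + 1 : ℕ) : ENNReal) = ENNReal.ofReal ((2 * R : ℝ) * n + 1) := by
      rw [← ENNReal.ofReal_natCast]; push_cast; rfl
    rw [h1, ← ENNReal.ofReal_mul (by positivity)]
    gcongr ENNReal.ofReal (_ * (2 * Real.exp ?_))
    rcases Nat.eq_zero_or_pos n with rfl | hn
    · simp [Real.zero_rpow (by positivity : (2 * e) ≠ 0)]
    · have hn' : (0 : ℝ) < n := by exact_mod_cast hn
      have h2 : ((n : ℝ) ^ (1 / 2 + e)) ^ 2 = n * (n : ℝ) ^ (2 * e) := by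
        rw [← Real.rpow_natCast, ← Real.rpow_mul hn'.le]
        nth_rewrite 2 [← Real.rpow_one (n : ℝ)]
        rw [← Real.rpow_add hn']
        congr 1
        push_cast
        ring
      rw [h2]
      apply le_of_eq
      field_simp
  have hfin : ∑' n, (Measure.infinitePi fun _ : ℕ => ν) (s n) ≠ ⊤ :=
    ((ENNReal.tsum_le_tsum hbound).trans_lt
      (summable_polynomial_mul_exp_neg_rpow (2 * R) (by positivity)).tsum_ofReal_lt_top).ne
  filter_upwards [ae_eventually_notMem hfin] with h hh
  filter_upwards [hh, eventually_gt_atTop 0] with n hn hn0 x hx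
  have hn' : (0 : ℝ) < n := by exact_mod_cast hn0
  have hx' := abs_le.1 hx
  have hxR : 0 ≤ (x + R) * n := by
    have : 0 ≤ x + R := by linarith
    positivity
  set j := ⌊(x + R) * n⌋₊ with hj
  have hj1 : (j : ℝ) ≤ (x + R) * n := Nat.floor_le hxR
  have hj2 : (x + R) * n < j + 1 := Nat.lt_floor_add_one _
  have hjle : j ∈ Finset.range (2 * R * n + 1) := by
    rw [Finset.mem_range, Nat.lt_succ_iff]
    have : (j : ℝ) ≤ (2 * R * n : ℕ) := by
      push_cast
      refine hj1.trans ?_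
      gcongr
      linarith
    exact_mod_cast this
  have hnot : ¬ (n : ℝ) ^ (1 / 2 + e) ≤ |∑ i ∈ Finset.range n,
        (Real.tanh (β * (((j : ℝ) / n - R) + h i))
          - ∫ y, Real.tanh (β * (((j : ℝ) / n - R) + y)) ∂ν)| := fun hcon =>
    hn (Set.mem_biUnion hjle hcon)
  rw [not_le] at hnot
  have hdist : |x - ((j : ℝ) / n - R)| ≤ 1 / n := by
    have h1 : x - ((j : ℝ) / n - R) = ((x + R) * n - j) / n := by field_simp; ring
    rw [h1, abs_div, abs_of_pos hn', abs_of_nonneg (by linarith)]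
    gcongr
    linarith
  refine (abs_sum_tanh_sub_le h n x ((j : ℝ) / n - R)).trans (add_le_add hnot.le ?_)
  calc (n : ℝ) * (2 * (|β| * |x - ((j : ℝ) / n - R)|)) ≤ n * (2 * (|β| * (1 / n))) := by gcongr
    _ = 2 * |β| := by field_simp

lemma eventually_rpow_add_le (C : ℝ) {a b : ℝ} (ha : 0 < a) (hab : a < b) :
    ∀ᶠ n : ℕ in atTop, (n : ℝ) ^ a + C ≤ (n : ℝ) ^ b := by
  have h1 : Tendsto (fun n : ℕ => (n : ℝ) ^ a) atTop atTop :=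
    (tendsto_rpow_atTop ha).comp tendsto_natCast_atTop_atTop
  have h2 : Tendsto (fun n : ℕ => (n : ℝ) ^ (b - a)) atTop atTop :=
    (tendsto_rpow_atTop (sub_pos.2 hab)).comp tendsto_natCast_atTop_atTop
  filter_upwards [h1.eventually_ge_atTop C, h2.eventually_ge_atTop 2, eventually_gt_atTop 0]
    with n hn1 hn2 hn0
  have hn' : (0 : ℝ) < n := by exact_mod_cast hn0
  have h3 : (n : ℝ) ^ b = (n : ℝ) ^ a * (n : ℝ) ^ (b - a) := by
    rw [← Real.rpow_add hn']; congr 1; ring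
  rw [h3]
  nlinarith [Real.rpow_pos_of_pos hn' a]

/-- Almost surely, the sums of `tanh (β (x + h i))` deviate from their means by at most
`n ^ (1 / 2 + e)`, uniformly for `x` in a bounded set. -/
lemma ae_eventually_abs_sum_tanh_le (R : ℕ) :
    ∀ᵐ h ∂(Measure.infinitePi fun _ : ℕ => ν), ∀ e : ℝ, 0 < e →
      ∀ᶠ n : ℕ in atTop, ∀ x : ℝ, |x| ≤ R →
        |∑ i : Fin n, Real.tanh (β * (x + h i)) - n * ∫ z, Real.tanh (β * (x + z)) ∂ν|
          ≤ (n : ℝ) ^ (1 / 2 + e) := by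
  -- Countably many exponents `1 / (j + 1)` suffice, so the exceptional null set does not depend on
  -- `e`, hence later not on `α`.
  have h1 : ∀ᵐ h ∂(Measure.infinitePi fun _ : ℕ => ν), ∀ j : ℕ, ∀ᶠ n : ℕ in atTop,
      ∀ x : ℝ, |x| ≤ R →
      |∑ i ∈ Finset.range n, (Real.tanh (β * (x + h i)) - ∫ z, Real.tanh (β * (x + z)) ∂ν)|
        ≤ (n : ℝ) ^ (1 / 2 + 1 / ((j : ℝ) + 1)) + 2 * |β| :=
    ae_all_iff.2 fun j => ae_eventually_abs_sum_tanh_le_add R Nat.one_div_pos_of_nat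
  filter_upwards [h1] with h hh e he
  obtain ⟨j, hj⟩ := exists_nat_one_div_lt he
  have hj0 : 0 < 1 / ((j : ℝ) + 1) := Nat.one_div_pos_of_nat
  filter_upwards [hh j, eventually_rpow_add_le (2 * |β|) (by positivity)
    (add_lt_add_right hj (1 / 2))] with n hn1 hn2 x hx
  have h2 := (hn1 x hx).trans hn2
  rw [Finset.sum_sub_distrib, Finset.sum_const, Finset.card_range, nsmul_eq_mul] at h2
  rwa [Fin.sum_univ_eq_sum_range (fun i => Real.tanh (β * (x + h i)))]

end

/-! ### Reduction of the deviations principle to balls and complements of balls -/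

lemma abs_le_one_add_pow {k : ℕ} (hk : 1 ≤ k) (y : ℝ) : |y| ≤ 1 + y ^ (2 * k) := by
  rw [← (even_two_mul k).pow_abs]
  rcases le_total |y| 1 with h | h
  · have := pow_nonneg (abs_nonneg y) (2 * k)
    linarith
  · have := le_self_pow₀ h (by omega : 2 * k ≠ 0)
    linarith

/-- `I` increases with `|y|`, so its infimum over a closed set is attained at a point nearest the
origin, and the set lies in the complement of the corresponding open ball. Upper bounds for such
complements and lower bounds for small balls are therefore enough. -/
lemma satisfiesLDP_of_bounds {P : ℕ → Measure ℝ} {a : ℕ → ℝ} {I : ℝ → ℝ} {A : ℝ} {k : ℕ}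
    (hk : 1 ≤ k) (hA : 0 < A) (hI : ∀ y, I y = A * y ^ (2 * k)) (ha : ∀ᶠ n in atTop, 0 < a n)
    (hupper : ∀ d : ℝ, 0 ≤ d → ∀ ε : ℝ, 0 < ε → ∀ᶠ n in atTop,
      P n {y | d ≤ |y|} ≤ ENNReal.ofReal (Real.exp (a n * (-(A * d ^ (2 * k)) + ε))))
    (hlower : ∀ y₀ r ε : ℝ, 0 < r → 0 < ε → ∀ᶠ n in atTop,
      ENNReal.ofReal (Real.exp (a n * (-(A * y₀ ^ (2 * k)) - ε))) ≤ P n (Metric.ball y₀ r)) :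
    SatisfiesLDP P a fun x => (I x : EReal) := by
  have hIcont : Continuous I := by
    rw [funext hI]; fun_prop
  refine ⟨?_, fun c => ?_, fun C hC => ?_, fun C hC => ?_⟩
  · exact (continuous_coe_real_ereal.comp hIcont).lowerSemicontinuous
  · simp only [EReal.coe_le_coe_iff]
    refine (isCompact_closedBall (0 : ℝ) (1 + c / A)).of_isClosed_subset
      (isClosed_le hIcont continuous_const) fun y hy => ?_
    rw [Set.mem_ofPred_eq, hI] at hy
    rw [Metric.mem_closedBall, dist_zero_right, Real.norm_eq_abs]
    refine (abs_le_one_add_pow hk y).trans ?_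
    rw [mul_comm] at hy
    linarith [(le_div_iff₀ hA).2 hy]
  · rw [EReal.neg_le]
    refine le_iInf₂ fun y₀ hy₀ => ?_
    rw [EReal.neg_le, ← EReal.coe_neg]
    refine EReal.ge_of_forall_gt_iff_ge.1 fun z hz => ?_
    rw [EReal.coe_lt_coe_iff, hI] at hz
    obtain ⟨r, hr, hball⟩ := Metric.isOpen_iff.1 isOpen_interior y₀ hy₀
    refine le_liminf_of_le (by isBoundedDefault) ?_
    filter_upwards [ha, hlower y₀ r (-(A * y₀ ^ (2 * k)) - z) hr (by linarith)] with n hn hlow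
    rw [EReal.le_div_iff_mul_le (by exact_mod_cast hn) (EReal.coe_ne_top _), ← EReal.coe_mul]
    rw [sub_sub_cancel] at hlow
    have h1 := ENNReal.log_le_log (hlow.trans (measure_mono (hball.trans interior_subset)))
    rwa [ENNReal.log_ofReal_of_pos (Real.exp_pos _), Real.log_exp, mul_comm] at h1
  -- The empty set has no nearest point; there both sides are `-∞` because the speed is eventually
  -- positive.
  · rcases C.eq_empty_or_nonempty with rfl | hne
    · simp only [measure_empty, ENNReal.log_zero, closure_empty, Set.mem_empty_iff_false,
        iInf_false, iInf_top, EReal.neg_top, le_bot_iff]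
      have : (fun n => (⊥ : EReal) / ((a n : ℝ) : EReal)) =ᶠ[atTop] fun _ => ⊥ := by
        filter_upwards [ha] with n hn
        exact EReal.bot_div_of_pos_ne_top (by exact_mod_cast hn) (EReal.coe_ne_top _)
      rw [limsup_congr this, limsup_const]
    · obtain ⟨y₀, hy₀, hmin⟩ := isClosed_closure.exists_infDist_eq_dist hne.closure (0 : ℝ)
      have hd : ∀ y ∈ C, |y₀| ≤ |y| := by
        intro y hy
        have h1 := Metric.infDist_le_dist_of_mem (x := (0 : ℝ)) (subset_closure hy)
        rw [hmin] at h1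
        simpa [Real.dist_eq] using h1
      refine le_trans ?_ (EReal.neg_le_neg_iff.2 (iInf₂_le y₀ hy₀))
      rw [← EReal.coe_neg]
      refine EReal.le_of_forall_lt_iff_le.1 fun z hz => ?_
      rw [EReal.coe_lt_coe_iff, hI] at hz
      refine limsup_le_of_le (by isBoundedDefault) ?_
      filter_upwards [ha, hupper |y₀| (abs_nonneg _) (z + A * y₀ ^ (2 * k)) (by linarith)]
        with n hn hup
      rw [(even_two_mul k).pow_abs] at hup
      rw [EReal.div_le_iff_le_mul (by exact_mod_cast hn) (EReal.coe_ne_top _), ← EReal.coe_mul]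
      rw [neg_add_cancel_comm_assoc] at hup
      have h1 := ENNReal.log_le_log ((measure_mono hd).trans hup)
      rwa [ENNReal.log_ofReal_of_pos (Real.exp_pos _), Real.log_exp] at h1

/-! ### Deterministic estimates for a typical realization of the field -/

section
variable {β : ℝ} {ν : Measure ℝ} [IsProbabilityMeasure ν]

lemma hasDerivAt_empG (β : ℝ) (h : ℕ → ℝ) (n : ℕ) (x : ℝ) :
    HasDerivAt (empG β h n) (n * (β * x) - β * ∑ i : Fin n, Real.tanh (β * (x + h i))) x := by
  have h1 : HasDerivAt (fun x : ℝ => (n : ℝ) * (β / 2 * x ^ 2)) (n * (β * x)) x := by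
    refine (((hasDerivAt_pow 2 x).const_mul (β / 2)).const_mul (n : ℝ)).congr_deriv ?_
    simp only [Nat.cast_ofNat, Nat.add_one_sub_one, pow_one]
    ring
  have h2 : HasDerivAt (fun x : ℝ => ∑ i : Fin n, Real.log (Real.cosh (β * (x + h i))))
      (∑ i : Fin n, Real.tanh (β * (x + h i)) * β) x := by
    refine HasDerivAt.fun_sum fun i _ => ?_
    have h3 : HasDerivAt (fun y : ℝ => β * (y + h i)) β x := by
      simpa using ((hasDerivAt_id x).add_const (h i)).const_mul β
    exact (hasDerivAt_log_cosh _).comp x h3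
  refine (h1.sub h2).congr_deriv ?_
  rw [← Finset.sum_mul, mul_comm β (∑ i : Fin n, _)]

/-- The derivative of `empG - n G` is `-β` times the centered `tanh` sum, so the mean value
inequality applies. Taking increments from `m` removes the fluctuation of `empG` at `m`, which
cancels in Gibbs probabilities. -/
lemma abs_empG_sub_le (hν : Integrable (fun x : ℝ => x ^ 2) ν) (h : ℕ → ℝ) (n : ℕ) {R D m x : ℝ}
    (hD : ∀ y, |y| ≤ R →
      |β| * |∑ i : Fin n, Real.tanh (β * (y + h i)) - n * ∫ z, Real.tanh (β * (y + z)) ∂ν| ≤ D)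
    (hm : |m| ≤ R) (hx : |x| ≤ R) :
    |empG β h n x - empG β h n m - n * (G β ν x - G β ν m)| ≤ D * |x - m| := by
  have hd : ∀ y, HasDerivAt (fun y => empG β h n y - n * G β ν y)
      (-β * (∑ i : Fin n, Real.tanh (β * (y + h i)) - n * ∫ z, Real.tanh (β * (y + z)) ∂ν)) y := by
    intro y
    refine ((hasDerivAt_empG β h n y).sub ((hasDerivAt_G hν y).const_mul (n : ℝ))).congr_deriv ?_
    rw [derivG]; ring
  have hsub : ∀ y ∈ Set.Icc (-R) R, |y| ≤ R := fun y hy => abs_le.2 hy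
  have := Convex.norm_image_sub_le_of_norm_hasDerivWithin_le (C := D)
    (s := Set.Icc (-R) R) (x := m) (y := x) (fun y _ => (hd y).hasDerivWithinAt)
    (fun y hy => by
      rw [norm_mul, norm_neg]
      exact hD y (hsub y hy))
    (convex_Icc _ _) (abs_le.1 hm) (abs_le.1 hx)
  rw [Real.norm_eq_abs, Real.norm_eq_abs] at this
  refine le_trans (le_of_eq ?_) this
  congr 1
  ring

end

section
variable {β : ℝ} {ν : Measure ℝ}

/-- A realization `h` of the field is controlled at scale `t` near `m`: the fluctuations of the
sums of `tanh` are negligible with respect to `n * t n ^ (2 * k - 1)`, and the speed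
`n * t n ^ (2 * k)` dominates `log n`. -/
structure Controlled (β : ℝ) (ν : Measure ℝ) (m : ℝ) (k : ℕ) (h : ℕ → ℝ)
    (t θ : ℕ → ℝ) : Prop where
  pos : ∀ᶠ n in atTop, 0 < t n
  tendsto_zero : Tendsto t atTop (𝓝 0)
  error_tendsto : Tendsto θ atTop (𝓝 0)
  speed_tendsto : Tendsto (fun n : ℕ => (n : ℝ) * t n ^ (2 * k)) atTop atTop
  log_le : ∀ ε : ℝ, 0 < ε → ∀ᶠ n : ℕ in atTop,
    Real.log (2 * n + 1) ≤ ε * ((n : ℝ) * t n ^ (2 * k))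
  -- The radius covers all fields in use: they lie within distance one of `m` or in `[-1, 1]`.
  deviation_le : ∀ᶠ n : ℕ in atTop, ∀ x, |x| ≤ |m| + 1 + 1 →
    |β| * |∑ i : Fin n, Real.tanh (β * (x + h i)) - n * ∫ z, Real.tanh (β * (x + z)) ∂ν|
      ≤ θ n * (n * t n ^ (2 * k - 1))

lemma Controlled.error_nonneg {m : ℝ} {k : ℕ} {h : ℕ → ℝ} {t θ : ℕ → ℝ}
    (hc : Controlled β ν m k h t θ) : ∀ᶠ n in atTop, 0 ≤ θ n := by
  filter_upwards [hc.deviation_le, hc.pos, eventually_gt_atTop 0] with n hn ht hn0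
  have hn' : (0 : ℝ) < n := by exact_mod_cast hn0
  have h1 := (by positivity : (0 : ℝ) ≤ _).trans (hn 0 (by rw [abs_zero]; positivity))
  exact nonneg_of_mul_nonneg_left h1 (by positivity)

/-- The exponent in units of the speed, uniformly in unbounded `y`: the linear fluctuation term is
absorbed by `1 + y^(2k)`, and the remaining coefficient `A - 2 ε₁ ≥ 0` allows `|y|` to be replaced
by `d`. -/
lemma near_exponent_le {A ε₁ θ' y d : ℝ} {k : ℕ} (hk : 1 ≤ k) (hd : 0 ≤ d) (hdy : d ≤ |y|)
    (hθ : θ' ≤ ε₁) (hε₁ : 0 ≤ ε₁) (hA : 2 * ε₁ ≤ A) :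
    -(A - ε₁) * y ^ (2 * k) + θ' * |y| ≤ -(A * d ^ (2 * k)) + ε₁ * (2 * d ^ (2 * k) + 1) := by
  have h1 := abs_le_one_add_pow hk y
  have h2 : d ^ (2 * k) ≤ y ^ (2 * k) := by
    rw [← (even_two_mul k).pow_abs y]; exact pow_le_pow_left₀ hd hdy _
  have h3 : θ' * |y| ≤ ε₁ * (1 + y ^ (2 * k)) :=
    (mul_le_mul_of_nonneg_right hθ (abs_nonneg _)).trans (mul_le_mul_of_nonneg_left h1 hε₁)
  nlinarith [mul_le_mul_of_nonneg_left h2 (by linarith : 0 ≤ A - 2 * ε₁)]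

/-- At fixed distance from `m` the rescaled `|y|` is huge, so half of the crude bound `κ y^(2k)`
already exceeds `A d^(2k)` while the other half absorbs the fluctuations. -/
lemma far_exponent_le {A ε κ θ y d : ℝ} {k : ℕ} (hk : 1 ≤ k) (hκ : 0 < κ) (hθκ : θ ≤ κ / 2)
    (hθε : θ ≤ ε) (hθ : 0 ≤ θ) (hy : 1 ≤ |y|) (hy2 : 2 * (A * d ^ (2 * k)) / κ ≤ |y|) :
    -κ * y ^ (2 * k) + θ * |y| ≤ -(A * d ^ (2 * k)) + ε := by
  have h1 := abs_le_one_add_pow hk y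
  have h2 : |y| ≤ y ^ (2 * k) := by
    rw [← (even_two_mul k).pow_abs y]; exact le_self_pow₀ hy (by omega)
  have h3 : θ * |y| ≤ θ * (1 + y ^ (2 * k)) := mul_le_mul_of_nonneg_left h1 hθ
  have h4 : 2 * (A * d ^ (2 * k)) ≤ y ^ (2 * k) * κ := (div_le_iff₀ hκ).1 (hy2.trans h2)
  have h5 : θ * y ^ (2 * k) ≤ κ / 2 * y ^ (2 * k) :=
    mul_le_mul_of_nonneg_right hθκ ((even_two_mul k).pow_nonneg _)
  linarith

lemma exp_neg_le_one_sub {p q : ℝ} (hp : Real.log 2 ≤ p) (hq : Real.log 4 ≤ q) :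
    Real.exp (-p) ≤ 1 - 2 * Real.exp (-q) := by
  have h1 : Real.exp (-p) ≤ 1 / 2 := by
    rw [one_div, ← Real.exp_log (by norm_num : (0 : ℝ) < 2), ← Real.exp_neg, Real.exp_le_exp]
    linarith
  have h2 : Real.exp (-q) ≤ 1 / 4 := by
    rw [one_div, ← Real.exp_log (by norm_num : (0 : ℝ) < 4), ← Real.exp_neg, Real.exp_le_exp]
    linarith
  linarith

variable [IsProbabilityMeasure ν]

/-- Every magnetization at distance at least `d * t n` from `n * m` admits an external field for
which the exponential bound has the right order. -/
lemma Controlled.exists_field (hν : Integrable (fun x : ℝ => x ^ 2) ν)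
    {m : ℝ} (hm : IsPureCenteredAt β ν m) {k : ℕ} (hk : 1 ≤ k) {c A : ℝ} (hc0 : 0 < c)
    (hA : 0 < A)
    (hexp : (fun w => β / 2 * ((1 - c) * w) ^ 2 - (G β ν (m + c * w) - G β ν m)
      + A * w ^ (2 * k)) =o[𝓝 0] fun w => w ^ (2 * k))
    {h : ℕ → ℝ} {t θ : ℕ → ℝ} (hc : Controlled β ν m k h t θ)
    {d ε : ℝ} (hd : 0 ≤ d) (hε : 0 < ε) :
    ∀ᶠ n : ℕ in atTop, ∀ y : ℝ, |m + t n * y| ≤ 1 → d ≤ |y| → ∃ x,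
      n * (β / 2) * (m + t n * y - x) ^ 2 - empG β h n x
        ≤ -empG β h n m + n * t n ^ (2 * k) * (-(A * d ^ (2 * k)) + ε) := by
  have hd2 : 0 ≤ d ^ (2 * k) := pow_nonneg hd _
  set ε₁ := min (A / 2) (ε / (2 * d ^ (2 * k) + 1)) with hε₁
  have hε₁pos : 0 < ε₁ := lt_min (by positivity) (by positivity)
  have hε₁A : 2 * ε₁ ≤ A := by linarith [min_le_left (A / 2) (ε / (2 * d ^ (2 * k) + 1))]
  have hε₁ε : ε₁ * (2 * d ^ (2 * k) + 1) ≤ ε :=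
    (le_div_iff₀ (by positivity)).1 (min_le_right _ _)
  obtain ⟨δ₀, hδ₀, hb⟩ := Metric.eventually_nhds_iff.1 (isLittleO_iff.1 hexp hε₁pos)
  -- `δ₀ / 2` stays inside the Taylor neighbourhood; `1 / c` keeps the field `m + c w` within
  -- distance one of `m`.
  set δ := min (δ₀ / 2) (1 / c) with hδ
  have hδpos : 0 < δ := lt_min (by positivity) (by positivity)
  obtain ⟨κ, hκ, hfar⟩ := exists_lower_bound hν hm k hδpos (|m| + 1)
  -- Once `t n` times this maximum is below `δ`, every `y` with `δ ≤ |t n * y|` is large enough for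
  -- `far_exponent_le`.
  have ht1 : ∀ᶠ n in atTop, t n * max 1 (2 * (A * d ^ (2 * k)) / κ) < δ := by
    have := hc.tendsto_zero.mul_const (max 1 (2 * (A * d ^ (2 * k)) / κ))
    rw [zero_mul] at this
    exact this.eventually_lt_const hδpos
  have hθ1 := hc.error_tendsto.eventually_le_const
    (lt_min (lt_min (half_pos hκ) hε) (by positivity : 0 < ε₁ / c))
  filter_upwards [ht1, hθ1, hc.error_nonneg, hc.pos, hc.deviation_le, eventually_gt_atTop 0]
    with n htn hθn hθ0 htpos hdev hn0 y hy1 hyd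
  have hn' : (0 : ℝ) < n := by exact_mod_cast hn0
  have hθκ : θ n ≤ κ / 2 := hθn.trans ((min_le_left _ _).trans (min_le_left _ _))
  have hθε : θ n ≤ ε := hθn.trans ((min_le_left _ _).trans (min_le_right _ _))
  have hθc : c * θ n ≤ ε₁ := by
    have := hθn.trans (min_le_right _ _)
    rwa [le_div_iff₀ hc0, mul_comm] at this
  have hmR : |m| ≤ |m| + 1 + 1 := by linarith
  have htk : t n ^ (2 * k - 1) * t n = t n ^ (2 * k) := by
    rw [← pow_succ]; congr 1; omega
  have hspeed : 0 ≤ n * t n ^ (2 * k) := by positivity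
  have hty : |t n * y| = t n * |y| := by rw [abs_mul, abs_of_pos htpos]
  have hwR : |t n * y| ≤ |m| + 1 := by
    have := abs_sub (m + t n * y) m
    rw [add_sub_cancel_left] at this
    linarith
  rcases le_total |t n * y| δ with hnear | hfar'
  · refine ⟨m + c * (t n * y), ?_⟩
    have hcw : |c * (t n * y)| ≤ 1 := by
      rw [abs_mul, abs_of_pos hc0]
      calc c * |t n * y| ≤ c * (1 / c) := by
            gcongr; exact hnear.trans (min_le_right _ _)
        _ = 1 := by field_simp
    have hxR : |m + c * (t n * y)| ≤ |m| + 1 + 1 := by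
      have := abs_add_le m (c * (t n * y)); linarith
    have h1 := (abs_le.1 (abs_empG_sub_le hν h n hdev hmR hxR)).1
    rw [add_sub_cancel_left, abs_mul, abs_of_pos hc0, hty] at h1
    have h2 := hb (y := t n * y) (by
      rw [Real.dist_eq, sub_zero]
      have := hnear.trans (min_le_left _ _)
      linarith)
    rw [Real.norm_eq_abs, Real.norm_of_nonneg ((even_two_mul k).pow_nonneg _)] at h2
    have h3 := mul_le_mul_of_nonneg_left ((le_abs_self _).trans h2) hn'.le
    have h4 := mul_le_mul_of_nonneg_left
      ((near_exponent_le hk hd hyd hθc hε₁pos.le hε₁A).trans (add_le_add_right hε₁ε _)) hspeed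
    have h5 : θ n * (n * t n ^ (2 * k - 1)) * (c * (t n * |y|))
        = n * t n ^ (2 * k) * (c * θ n * |y|) := by rw [← htk]; ring
    rw [h5] at h1
    rw [show m + t n * y - (m + c * (t n * y)) = (1 - c) * (t n * y) by ring]
    refine le_trans ?_ (add_le_add_right h4 _)
    rw [mul_pow (t n) y (2 * k)] at h3
    linarith
  -- Far from `m` no optimal field is needed: taking the field equal to the magnetization kills the
  -- quadratic term, and `G` is bounded below by `hfar`.
  · refine ⟨m + t n * y, ?_⟩
    have hxR : |m + t n * y| ≤ |m| + 1 + 1 := by linarith [abs_nonneg m]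
    have h1 := (abs_le.1 (abs_empG_sub_le hν h n hdev hmR hxR)).1
    rw [add_sub_cancel_left, hty] at h1
    have h2 := mul_le_mul_of_nonneg_left (hfar _ hfar' hwR) hn'.le
    have hyM : max 1 (2 * (A * d ^ (2 * k)) / κ) ≤ |y| := by
      rw [hty] at hfar'
      exact (lt_of_mul_lt_mul_left (htn.trans_le hfar') htpos.le).le
    have h4 := mul_le_mul_of_nonneg_left (far_exponent_le (d := d) hk hκ hθκ hθε hθ0
      ((le_max_left _ _).trans hyM) ((le_max_right _ _).trans hyM)) hspeed
    have h5 : θ n * (n * t n ^ (2 * k - 1)) * (t n * |y|)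
        = n * t n ^ (2 * k) * (θ n * |y|) := by rw [← htk]; ring
    rw [h5] at h1
    rw [mul_pow] at h2
    rw [sub_self]
    refine le_trans ?_ (add_le_add_right h4 _)
    linarith

lemma abs_magnetization_le {n : ℕ} (σ : Fin n → ℤˣ) : |magnetization σ| ≤ n := by
  refine (Finset.abs_sum_le_sum_abs _ _).trans ?_
  have : ∀ i, |((σ i : ℤ) : ℝ)| = 1 := fun i => by
    rw [← Int.cast_abs, Int.isUnit_iff_abs_eq.1 (Units.isUnit (σ i)), Int.cast_one]
  simp [this]

/-- Upper bound for the weight of configurations with magnetization away from `n * m`. -/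
lemma Controlled.sum_weight_le (hν : Integrable (fun x : ℝ => x ^ 2) ν)
    {m : ℝ} (hm : IsPureCenteredAt β ν m) {k : ℕ} (hk : 1 ≤ k) {c A : ℝ} (hc0 : 0 < c)
    (hA : 0 < A)
    (hexp : (fun w => β / 2 * ((1 - c) * w) ^ 2 - (G β ν (m + c * w) - G β ν m)
      + A * w ^ (2 * k)) =o[𝓝 0] fun w => w ^ (2 * k))
    {h : ℕ → ℝ} {t θ : ℕ → ℝ} (hc : Controlled β ν m k h t θ)
    {d ε : ℝ} (hd : 0 ≤ d) (hε : 0 < ε) :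
    ∀ᶠ n : ℕ in atTop, ∀ B : Finset (Fin n → ℤˣ),
      (∀ σ ∈ B, d ≤ |(magnetization σ / n - m) / t n|) →
      ∑ σ ∈ B, weight β h σ ≤ 2 ^ n * Real.exp (-empG β h n m
        + n * t n ^ (2 * k) * (-(A * d ^ (2 * k)) + ε)) := by
  filter_upwards [hc.exists_field hν hm hk hc0 hA hexp hd (half_pos hε),
    hc.log_le _ (half_pos hε), hc.pos, eventually_gt_atTop 0] with n hn hlog htpos hn0 B hB
  have hn' : (0 : ℝ) < n := by exact_mod_cast hn0
  have h1 := RFCW.sum_weight_le (β := β) h hn0.ne' B _ fun σ hσ => by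
    have hu : m + t n * ((magnetization σ / n - m) / t n) = magnetization σ / n := by
      field_simp; ring
    have hle : |magnetization σ / n| ≤ 1 := by
      rw [abs_div, abs_of_pos hn', div_le_one hn']; exact abs_magnetization_le σ
    have := hn ((magnetization σ / n - m) / t n) (by rw [hu]; exact hle) (hB σ hσ)
    rwa [hu] at this
  refine h1.trans ?_
  -- The number of magnetization levels goes into the exponent, where it costs half of `ε`.
  rw [mul_left_comm, ← Real.exp_log (by positivity : (0 : ℝ) < 2 * n + 1), ← Real.exp_add]
  refine mul_le_mul_of_nonneg_left (Real.exp_le_exp.2 ?_) (by positivity)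
  linarith

/-- Lower bound for the weight of configurations with magnetization close to
`n * (m + t n * y₀)`. -/
lemma Controlled.sum_weight_ge (hβ : 0 < β) (hν : Integrable (fun x : ℝ => x ^ 2) ν)
    {m : ℝ} {k : ℕ} (hk : 1 ≤ k) {c A : ℝ} (hc0 : 0 < c) (hkc : k = 1 ∨ c = 1)
    (hexp : (fun w => β / 2 * ((1 - c) * w) ^ 2 - (G β ν (m + c * w) - G β ν m)
      + A * w ^ (2 * k)) =o[𝓝 0] fun w => w ^ (2 * k))
    (hder : (fun w => c * w - derivG β ν (m + c * w) / β - w) =o[𝓝 0] fun w => w)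
    {h : ℕ → ℝ} {t θ : ℕ → ℝ} (hc : Controlled β ν m k h t θ)
    (y₀ : ℝ) {r ε : ℝ} (hr : 0 < r) (hε : 0 < ε) :
    ∀ᶠ n : ℕ in atTop, ∀ B : Finset (Fin n → ℤˣ),
      (∀ σ, |(magnetization σ / n - m) / t n - y₀| < r → σ ∈ B) →
      2 ^ n * Real.exp (-empG β h n m + n * t n ^ (2 * k) * (-(A * y₀ ^ (2 * k)) - ε))
        ≤ ∑ σ ∈ B, weight β h σ := by
  classical
  set Y := |y₀| + 1 with hY
  have hYpos : 0 < Y := by positivity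
  have hy0 : 0 ≤ y₀ ^ (2 * k) := (even_two_mul k).pow_nonneg _
  -- The ball is shrunk so that the cross term in the quadratic factor costs at most `ε / 4`; the
  -- added ones avoid division by zero when `c = 1` or `y₀ = 0`. The other quarters of `ε` pay for
  -- the fluctuations, the Taylor remainder and the concentration factor.
  set ρ := min r (ε / 4 / (β * (|1 - c| + 1) * Y)) with hρ
  have hρpos : 0 < ρ := lt_min hr (by positivity)
  have hρε : β * |1 - c| * |y₀| * ρ ≤ ε / 4 := by
    have h1 : ρ * (β * (|1 - c| + 1) * Y) ≤ ε / 4 :=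
      (le_div_iff₀ (by positivity)).1 (min_le_right _ _)
    refine le_trans ?_ h1
    rw [mul_comm ρ]
    gcongr <;> linarith
  have hw : Tendsto (fun n => t n * y₀) atTop (𝓝 0) := by
    simpa using hc.tendsto_zero.mul_const y₀
  have hexp' := hw.eventually (isLittleO_iff.1 hexp
    (by positivity : 0 < ε / 4 / (y₀ ^ (2 * k) + 1)))
  have hder' := hw.eventually (isLittleO_iff.1 hder (by positivity : 0 < ρ / 4 / Y))
  have hcw : ∀ᶠ n in atTop, |c * (t n * y₀)| < 1 := by
    have := (hw.const_mul c).abs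
    rw [mul_zero, abs_zero] at this
    exact this.eventually_lt_const one_pos
  have hθ1 := hc.error_tendsto.eventually_le_const
    (lt_min (by positivity : 0 < ε / 4 / (c * Y)) (by positivity : 0 < β * (ρ / 4)))
  have ht1 := hc.tendsto_zero.eventually_le_const one_pos
  have hspeed1 := hc.speed_tendsto.eventually_ge_atTop (max (Real.log 4 * (8 / ρ ^ 2))
    (Real.log 2 * (4 / ε)))
  filter_upwards [hexp', hder', hcw, hθ1, ht1, hspeed1, hc.error_nonneg, hc.pos,
    hc.deviation_le, eventually_gt_atTop 0]
    with n hexpn hdern hcwn hθn htn hspn hθ0 htpos hdev hn0 B hB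
  have hn' : (0 : ℝ) < n := by exact_mod_cast hn0
  have hθc : θ n * (c * |y₀|) ≤ ε / 4 := by
    have h1 := hθn.trans (min_le_left _ _)
    rw [le_div_iff₀ (by positivity)] at h1
    refine le_trans ?_ h1
    gcongr
    linarith
  have hθβ : θ n ≤ β * (ρ / 4) := hθn.trans (min_le_right _ _)
  have hmR : |m| ≤ |m| + 1 + 1 := by linarith
  have htk : t n ^ (2 * k - 1) * t n = t n ^ (2 * k) := by
    rw [← pow_succ]; congr 1; omega
  have htk1 : t n ^ (2 * k - 1) ≤ t n := pow_le_of_le_one htpos.le htn (by omega)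
  have htk2 : t n ^ (2 * k) ≤ t n ^ 2 := pow_le_pow_of_le_one htpos.le htn (by omega)
  have hspeed : 0 ≤ n * t n ^ (2 * k) := by positivity
  set x := m + c * (t n * y₀) with hx
  have hxR : |x| ≤ |m| + 1 + 1 := by
    have := abs_add_le m (c * (t n * y₀)); linarith
  -- the mean magnetization under the external field `x`
  have hmean : |∑ i : Fin n, Real.tanh (β * (x + h i)) - n * (m + t n * y₀)|
      ≤ n * (t n * ρ / 2) := by
    have h1 : |∑ i : Fin n, Real.tanh (β * (x + h i)) - n * ∫ z, Real.tanh (β * (x + z)) ∂ν|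
        ≤ n * (t n * ρ / 4) := by
      have h2 := hdev x hxR
      rw [abs_of_pos hβ] at h2
      have h3 : θ n * (n * t n ^ (2 * k - 1)) ≤ β * (ρ / 4) * (n * t n) := by gcongr
      refine le_of_mul_le_mul_left (h2.trans (h3.trans_eq ?_)) hβ
      ring
    have h4 : |n * ∫ z, Real.tanh (β * (x + z)) ∂ν - n * (m + t n * y₀)|
        ≤ n * (t n * ρ / 4) := by
      rw [← mul_sub, abs_mul, abs_of_pos hn']
      refine mul_le_mul_of_nonneg_left ?_ hn'.le
      have h5 : ∫ z, Real.tanh (β * (x + z)) ∂ν - (m + t n * y₀)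
          = c * (t n * y₀) - derivG β ν x / β - t n * y₀ := by
        rw [derivG, hx]; field_simp; ring
      rw [h5]
      refine hdern.trans ?_
      rw [Real.norm_eq_abs, abs_mul, abs_of_pos htpos]
      calc ρ / 4 / Y * (t n * |y₀|) ≤ ρ / 4 / Y * (t n * Y) := by gcongr; linarith
        _ = t n * ρ / 4 := by field_simp
    have := abs_sub_le (∑ i : Fin n, Real.tanh (β * (x + h i)))
      (n * ∫ z, Real.tanh (β * (x + z)) ∂ν) (n * (m + t n * y₀))
    linarith
  set B' := Finset.univ.filter fun σ : Fin n → ℤˣ =>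
    |(magnetization σ / n - m) / t n - y₀| < ρ with hB'
  have hB'B : B' ⊆ B := fun σ hσ =>
    hB σ ((Finset.mem_filter.1 hσ).2.trans_le (min_le_left _ _))
  have hscale : ∀ σ : Fin n → ℤˣ, magnetization σ - n * (m + t n * y₀)
      = n * t n * ((magnetization σ / n - m) / t n - y₀) := fun σ => by
    field_simp; ring
  -- The tilted mean is within `n t ρ / 2` of the target and the concentration window has the same
  -- half-width, so together they stay in the ball of radius `ρ`. The constant is `((1 - c) y₀ +
  -- z)^2` bounded below by dropping `z^2`.
  have hmain := RFCW.sum_weight_ge (β := β) h hn0.ne' x (t n * ρ / 2)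
    (n * (β / 2) * t n ^ 2 * (((1 - c) * y₀) ^ 2 - 2 * (|1 - c| * |y₀| * ρ))) (by positivity) B'
    (fun σ hσ => by
      rw [hB', Finset.mem_filter]
      refine ⟨Finset.mem_univ _, ?_⟩
      have h1 := abs_sub_le (magnetization σ) (∑ i : Fin n, Real.tanh (β * (x + h i)))
        (n * (m + t n * y₀))
      rw [hscale, abs_mul, abs_of_pos (mul_pos hn' htpos)] at h1
      have h2 : n * t n * |(magnetization σ / n - m) / t n - y₀| < n * t n * ρ := by linarith
      exact lt_of_mul_lt_mul_left h2 (by positivity))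
    (fun σ hσ => by
      set z := (magnetization σ / n - m) / t n - y₀ with hz
      have hzρ : |z| < ρ := (Finset.mem_filter.1 hσ).2
      have h1 : magnetization σ / n - x = t n * ((1 - c) * y₀ + z) := by
        rw [hz, hx]; field_simp; ring
      rw [h1, mul_pow (t n), ← mul_assoc (n * (β / 2)) (t n ^ 2)]
      refine mul_le_mul_of_nonneg_left ?_ (by positivity)
      have h2 : -(|1 - c| * |y₀| * ρ) ≤ (1 - c) * y₀ * z := by
        have h3 := neg_abs_le ((1 - c) * y₀ * z)
        rw [abs_mul, abs_mul] at h3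
        have h4 : |1 - c| * |y₀| * |z| ≤ |1 - c| * |y₀| * ρ := by gcongr
        linarith
      nlinarith [sq_nonneg z])
  refine le_trans ?_ (Finset.sum_le_sum_of_subset_of_nonneg hB'B
    fun σ _ _ => (weight_pos β h σ).le)
  refine le_trans ?_ hmain
  -- the concentration factor
  have hfactor : Real.exp (-(n * t n ^ (2 * k) * (ε / 4)))
      ≤ 1 - 2 * Real.exp (-(n * (t n * ρ / 2) ^ 2 / 2)) := by
    refine exp_neg_le_one_sub ?_ ?_
    · have h2 := (le_max_right _ _).trans hspn
      have h3 := mul_le_mul_of_nonneg_right h2 (by positivity : 0 ≤ ε / 4)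
      rwa [mul_assoc, show 4 / ε * (ε / 4) = 1 by field_simp, mul_one] at h3
    · have h2 := ((le_max_left _ _).trans hspn).trans (mul_le_mul_of_nonneg_left htk2 hn'.le)
      have h3 := mul_le_mul_of_nonneg_right h2 (by positivity : 0 ≤ ρ ^ 2 / 8)
      rw [mul_assoc, show 8 / ρ ^ 2 * (ρ ^ 2 / 8) = 1 by field_simp, mul_one] at h3
      linarith
  rw [mul_assoc (2 ^ n)]
  refine mul_le_mul_of_nonneg_left ?_ (by positivity)
  refine le_trans ?_ (mul_le_mul_of_nonneg_left hfactor (Real.exp_pos _).le)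
  rw [← Real.exp_add, Real.exp_le_exp]
  have h1 := (abs_le.1 (abs_empG_sub_le hν h n hdev hmR hxR)).2
  have h2 : |x - m| = t n * (c * |y₀|) := by
    rw [hx, add_sub_cancel_left, abs_mul, abs_mul, abs_of_pos hc0, abs_of_pos htpos]; ring
  have h3 : θ n * (n * t n ^ (2 * k - 1)) * (t n * (c * |y₀|))
      = n * t n ^ (2 * k) * (θ n * (c * |y₀|)) := by rw [← htk]; ring
  rw [h2, h3] at h1
  have h4 := mul_le_mul_of_nonneg_left hθc hspeed
  rw [Real.norm_eq_abs, Real.norm_of_nonneg ((even_two_mul k).pow_nonneg _)] at hexpn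
  have h5 := mul_le_mul_of_nonneg_left (neg_le_of_abs_le hexpn) hn'.le
  have h6 : ε / 4 / (y₀ ^ (2 * k) + 1) * (t n * y₀) ^ (2 * k) ≤ t n ^ (2 * k) * (ε / 4) := by
    rw [mul_pow, div_mul_eq_mul_div, div_le_iff₀ (by positivity)]
    have : 0 ≤ t n ^ (2 * k) * (ε / 4) := by positivity
    linarith
  have h7 := mul_le_mul_of_nonneg_left h6 hn'.le
  -- The cross term has order `n t^2`, which is the speed only for `k = 1`; otherwise `c = 1`
  -- removes it.
  have h8 : n * (β / 2) * t n ^ 2 * (2 * (|1 - c| * |y₀| * ρ)) ≤ n * t n ^ (2 * k) * (ε / 4) := by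
    rcases hkc with rfl | rfl
    · have := mul_le_mul_of_nonneg_left hρε hspeed
      linarith
    · simp only [sub_self, abs_zero, zero_mul, mul_zero]
      positivity
  rw [mul_pow (t n) y₀] at h5
  rw [mul_pow (t n) y₀] at h7
  have h9 : n * (β / 2 * ((1 - c) * (t n * y₀)) ^ 2)
      = n * (β / 2) * t n ^ 2 * ((1 - c) * y₀) ^ 2 := by ring
  linarith

end

/-! ### The scale `n ^ (α - 1)` and the moderate deviations principle for a fixed realization -/

section
variable {β : ℝ} {ν : Measure ℝ}

/-- A realization with fluctuations of order `n ^ (1 / 2 + e)` for all `e > 0` is controlled at the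
scale `n ^ (α - 1)` of moderate deviations. -/
lemma controlled_of_deviation_le {m : ℝ} {k : ℕ} (hk : 1 ≤ k) {R : ℝ}
    (hR : |m| + 1 + 1 ≤ R) {h : ℕ → ℝ}
    (hdev : ∀ e : ℝ, 0 < e → ∀ᶠ n : ℕ in atTop, ∀ x : ℝ, |x| ≤ R →
      |∑ i : Fin n, Real.tanh (β * (x + h i)) - n * ∫ z, Real.tanh (β * (x + z)) ∂ν|
        ≤ (n : ℝ) ^ (1 / 2 + e))
    {α : ℝ} (hα : 1 - 1 / (2 * (2 * (k : ℝ) - 1)) < α) (hα1 : α < 1) :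
    ∃ θ, Controlled β ν m k h (fun n : ℕ => (n : ℝ) ^ (α - 1)) θ := by
  have hk' : (1 : ℝ) ≤ k := by exact_mod_cast hk
  have hpos : 0 < 2 * (k : ℝ) - 1 := by linarith
  -- This is the lower bound on `α` rewritten. With `e` half of this gap, `n^(1/2 + e)` is `n t^(2k
  -- - 1)` times `n^(-e)`.
  have hgap : 0 < 1 / 2 + (2 * (k : ℝ) - 1) * (α - 1) := by
    have h1 : (1 - α) * (2 * (2 * (k : ℝ) - 1)) < 1 := by
      rw [← lt_div_iff₀ (by positivity)]; linarith
    linarith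
  -- Since `k ≥ 1`, `2k (1 - α) ≤ 2 (2k - 1)(1 - α) < 1`.
  have hspeedpos : 0 < 1 + 2 * (k : ℝ) * (α - 1) := by nlinarith
  set e := (1 / 2 + (2 * (k : ℝ) - 1) * (α - 1)) / 2 with he
  have hepos : 0 < e := by positivity
  have hspeed : ∀ᶠ n : ℕ in atTop,
      (n : ℝ) ^ (1 + 2 * (k : ℝ) * (α - 1)) = n * ((n : ℝ) ^ (α - 1)) ^ (2 * k) := by
    filter_upwards [eventually_gt_atTop 0] with n hn
    have hn' : (0 : ℝ) < n := by exact_mod_cast hn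
    rw [Real.rpow_add hn', Real.rpow_one, ← Real.rpow_mul_natCast hn'.le]
    congr 2
    push_cast
    ring
  have hspeed_tendsto : Tendsto (fun n : ℕ => (n : ℝ) ^ (1 + 2 * (k : ℝ) * (α - 1))) atTop atTop :=
    (tendsto_rpow_atTop hspeedpos).comp tendsto_natCast_atTop_atTop
  refine ⟨fun n => |β| * (n : ℝ) ^ (-e), ?_, ?_, ?_, hspeed_tendsto.congr' hspeed, ?_, ?_⟩
  · filter_upwards [eventually_gt_atTop 0] with n hn
    have hn' : (0 : ℝ) < n := by exact_mod_cast hn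
    exact Real.rpow_pos_of_pos hn' _
  · have := (tendsto_rpow_neg_atTop (sub_pos.2 hα1)).comp tendsto_natCast_atTop_atTop
    simpa [Function.comp_def] using this
  · have := ((tendsto_rpow_neg_atTop hepos).comp tendsto_natCast_atTop_atTop).const_mul |β|
    simpa [Function.comp_def] using this
  · intro ε hε
    have hlog := (((isLittleO_log_rpow_atTop hspeedpos).comp_tendsto
      tendsto_natCast_atTop_atTop).bound (half_pos hε))
    have hlog3 := hspeed_tendsto.eventually_ge_atTop (Real.log 3 / (ε / 2))
    filter_upwards [hlog, hlog3, hspeed, eventually_gt_atTop 0] with n h1 h2 h3 hn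
    have hn' : (1 : ℝ) ≤ n := by exact_mod_cast hn
    rw [Function.comp_apply, Function.comp_apply,
      Real.norm_of_nonneg (Real.rpow_nonneg (by positivity) _)] at h1
    rw [← h3]
    rw [div_le_iff₀ (by positivity)] at h2
    have h4 : Real.log (2 * n + 1) ≤ Real.log 3 + Real.log n := by
      rw [← Real.log_mul (by norm_num) (by positivity)]
      exact Real.log_le_log (by positivity) (by linarith)
    have h5 := (le_abs_self _).trans h1
    linarith
  · filter_upwards [hdev e hepos, eventually_gt_atTop 0] with n hn hn0 x hx
    have hn' : (0 : ℝ) < n := by exact_mod_cast hn0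
    have h1 : (n : ℝ) ^ (-e) * (n * ((n : ℝ) ^ (α - 1)) ^ (2 * k - 1)) = (n : ℝ) ^ (1 / 2 + e) := by
      rw [← Real.rpow_mul_natCast hn'.le]
      nth_rewrite 2 [← Real.rpow_one (n : ℝ)]
      rw [← Real.rpow_add hn', ← Real.rpow_add hn']
      congr 1
      rw [Nat.cast_sub (by omega)]
      push_cast
      rw [he]
      ring
    rw [mul_assoc, h1]
    exact mul_le_mul_of_nonneg_left (hn x (hx.trans hR)) (abs_nonneg _)

lemma scaled_eq (m α s : ℝ) {n : ℕ} (hn : 0 < n) :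
    (s - n * m) / (n : ℝ) ^ α = (s / n - m) / (n : ℝ) ^ (α - 1) := by
  have hn' : (0 : ℝ) < n := by exact_mod_cast hn
  rw [Real.rpow_sub_one hn'.ne']
  field_simp

variable [IsProbabilityMeasure ν]

/-- Numerator and partition function share the factor `2^n exp (-empG m)`, so the random value `empG
m` never has to be estimated. -/
lemma Controlled.satisfiesLDP (hβ : 0 < β) (hν : Integrable (fun x : ℝ => x ^ 2) ν)
    {m : ℝ} (hm : IsPureCenteredAt β ν m) {k : ℕ} {lam : ℝ} (hk : HasTypeStrength β ν m k lam)
    {h : ℕ → ℝ} {α : ℝ} {θ : ℕ → ℝ}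
    (hc : Controlled β ν m k h (fun n : ℕ => (n : ℝ) ^ (α - 1)) θ) :
    SatisfiesLDP (fun n : ℕ => scaledMagnetizationLaw β h m α n)
      (fun n : ℕ => (n : ℝ) ^ (1 - 2 * (k : ℝ) * (1 - α)))
      (fun x : ℝ => ((rateFunction β k lam x : ℝ) : EReal)) := by
  classical
  have hk1 := hk.one_le_type
  obtain ⟨c, A, hc0, hA, hkc, hI, hexp, hder⟩ := exists_local_expansion hβ hν hm hk
  have hspeed : ∀ n : ℕ, 0 < n → (n : ℝ) ^ (1 - 2 * (k : ℝ) * (1 - α))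
      = n * ((n : ℝ) ^ (α - 1)) ^ (2 * k) := by
    intro n hn
    have hn' : (0 : ℝ) < n := by exact_mod_cast hn
    rw [← Real.rpow_mul_natCast hn'.le]
    nth_rewrite 2 [← Real.rpow_one (n : ℝ)]
    rw [← Real.rpow_add hn']
    congr 1
    push_cast
    ring
  have hZpos : ∀ n : ℕ, 0 < partitionFunction β h n := fun n =>
    Finset.sum_pos (fun _ _ => Real.exp_pos _) Finset.univ_nonempty
  refine satisfiesLDP_of_bounds hk1 hA hI ?_ (fun d hd ε hε => ?_) (fun y₀ r ε hr hε => ?_)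
  · filter_upwards [eventually_gt_atTop 0] with n hn
    exact Real.rpow_pos_of_pos (by exact_mod_cast hn) _
  · filter_upwards [hc.sum_weight_le hν hm hk1 hc0 hA hexp hd hε, eventually_gt_atTop 0]
      with n hn hn0
    have hmeas : MeasurableSet {y : ℝ | d ≤ |y|} :=
      (isClosed_le continuous_const continuous_abs).measurableSet
    rw [scaledMagnetizationLaw_apply _ _ _ _ _ hmeas]
    refine ENNReal.ofReal_le_ofReal ?_
    rw [div_le_iff₀ (hZpos n), hspeed n hn0]
    refine (hn _ fun σ hσ => ?_).trans ?_
    · rw [← scaled_eq m α _ hn0]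
      exact (Finset.mem_filter.1 hσ).2
    · refine le_trans (le_of_eq ?_) (mul_le_mul_of_nonneg_left
        (partitionFunction_ge hβ h hn0.ne' m) (Real.exp_pos _).le)
      rw [Real.exp_add]
      ring
  · filter_upwards [hc.sum_weight_le hν hm hk1 hc0 hA hexp le_rfl (half_pos hε),
      hc.sum_weight_ge hβ hν hk1 hc0 hkc hexp hder y₀ hr (half_pos hε), eventually_gt_atTop 0]
      with n hnZ hn hn0
    rw [scaledMagnetizationLaw_apply _ _ _ _ _ measurableSet_ball]
    refine ENNReal.ofReal_le_ofReal ?_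
    -- With `d = 0` every configuration qualifies, so the upper estimate bounds the partition
    -- function itself, with an excess of only `ε / 2` in units of the speed.
    have hZ : partitionFunction β h n ≤ _ := hnZ Finset.univ fun σ _ => abs_nonneg _
    rw [le_div_iff₀ (hZpos n), hspeed n hn0]
    refine (mul_le_mul_of_nonneg_left hZ (Real.exp_pos _).le).trans
      (le_trans (le_of_eq ?_) (hn _ fun σ hσ => ?_))
    · rw [mul_left_comm, ← Real.exp_add, zero_pow (by omega)]
      congr 2
      ring
    · rw [Finset.mem_filter]
      refine ⟨Finset.mem_univ _, ?_⟩
      rw [scaled_eq m α _ hn0, Metric.mem_ball, Real.dist_eq]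
      exact hσ

end

end RFCW

theorem mainTheorem2 (β : ℝ) (hβ : 0 < β)
    (ν : Measure ℝ) [IsProbabilityMeasure ν]
    (hν : Integrable (fun x : ℝ => x ^ 2) ν)
    (m : ℝ) (hm : RFCW.IsPureCenteredAt β ν m)
    (k : ℕ) (lam : ℝ) (hk : RFCW.HasTypeStrength β ν m k lam) :
    ∀ᵐ h ∂(Measure.infinitePi fun _ : ℕ => ν),
      ∀ α : ℝ, 1 - 1 / (2 * (2 * (k : ℝ) - 1)) < α → α < 1 →
        RFCW.SatisfiesLDP
          (fun n : ℕ => RFCW.scaledMagnetizationLaw β h m α n)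
          (fun n : ℕ => (n : ℝ) ^ (1 - 2 * (k : ℝ) * (1 - α)))
          (fun x : ℝ => ((RFCW.rateFunction β k lam x : ℝ) : EReal)) := by
  obtain ⟨R, hR⟩ := exists_nat_ge (|m| + 1 + 1)
  filter_upwards [RFCW.ae_eventually_abs_sum_tanh_le (β := β) (ν := ν) R] with h hdev α hα hα1
  obtain ⟨θ, hθ⟩ := RFCW.controlled_of_deviation_le hk.one_le_type hR hdev hα hα1
  exact hθ.satisfiesLDP hβ hν hm hk
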